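/- Let $0<\delta<1$. For $\alpha\in(\delta-1,1-\delta)$ let $G_{\alpha,\delta}$ be the Green function with pole at infinity of the domain $\overline{\mathbb C}\setminus E(\alpha,\delta)$, $E(\alpha,\delta)=[-1,1]\setminus(\alpha-\delta,\alpha+\delta)$, and let $G_\delta$ be the Green function with pole at infinity of $\overline{\mathbb C}\setminus[-1+2\delta,1]$; both are extended by $0$ to the removed set. For every $\alpha\in(\delta-1,0]$ and every $x$ in the gap $(\alpha-\delta,\alpha+\delta)$ the derivative $\partial_\alpha G_{\alpha,\delta}(x)$ exists, and the equation $\partial_\alpha G_{\alpha,\delta}(x)=0$ has exactly one solution $x=x_0(\alpha)$ in the gap. Let $x_0\in(-1,0]$. Then the supremum $$\Phi_\delta(x_0)=\sup_{\alpha\in(\delta-1,0]}G_{\alpha,\delta}(x_0)$$ is finite. If it is attained at some $\alpha\in(\delta-1,0]$, then $x_0\in(\alpha-\delta,\alpha+\delta)$ and $x_0=x_0(\alpha)$, i.e. $x_0$ is the unique solution $x$ in $(\alpha-\delta,\alpha+\delta)$ of $\partial_\alpha G_{\alpha,\delta}(x)=0$. If it is not attained at any $\alpha\in(\delta-1,0]$,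 then $\Phi_\delta(x_0)=\lim_{\alpha\to(\delta-1)^+}G_{\alpha,\delta}(x_0)=G_\delta(x_0)$. -/

import Mathlib

open Set Filter Topology

/-- `g` is the Green function, with pole at infinity, of the complement of the compact set `E` in
the Riemann sphere, extended by zero to `E`: it is harmonic on `ℂ \ E`, differs from `log |z|` by
a bounded function near infinity, and has boundary values zero on `E` (continuity on the whole
plane together with vanishing on `E`). By the maximum principle there is at most one such `g` when
`E` is nonempty and compact. -/
structure IsGreenAtInfty (E : Set ℂ) (g : ℂ → ℝ) : Prop where
  harmonic : InnerProductSpace.HarmonicOnNhd g Eᶜ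
  continuous : Continuous g
  eq_zero : ∀ z ∈ E, g z = 0
  log_pole : (fun z : ℂ => g z - Real.log ‖z‖) =O[Bornology.cobounded ℂ] (fun _ => (1 : ℝ))

open Classical in
/-- The Green function of the complement of `E` with pole at infinity (`0` if there is none). -/
noncomputable def greenAtInfty (E : Set ℂ) : ℂ → ℝ :=
  if h : ∃ g, IsGreenAtInfty E g then h.choose else 0

/-- `E(α, δ) = [-1, 1] \ (α - δ, α + δ)`, as a subset of the complex plane. -/
def twoIntervals (α δ : ℝ) : Set ℂ :=
  (fun t : ℝ => (t : ℂ)) '' (Icc (-1) 1 \ Ioo (α - δ) (α + δ))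

/-- `E(δ) = [-1 + 2δ, 1]`, as a subset of the complex plane. -/
def oneInterval (δ : ℝ) : Set ℂ :=
  (fun t : ℝ => (t : ℂ)) '' Icc (-1 + 2 * δ) 1

/-- `G_{α,δ}(x)` for real `x`. -/
noncomputable def greenTwo (α δ x : ℝ) : ℝ := greenAtInfty (twoIntervals α δ) (x : ℂ)

/-- `G_δ(x)` for real `x`. -/
noncomputable def greenOne (δ x : ℝ) : ℝ := greenAtInfty (oneInterval δ) (x : ℂ)

/-- The upper envelope `Φ_δ(x) = sup_{α ∈ (δ - 1, 0]} G_{α,δ}(x)`. -/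
noncomputable def upperEnvelope (δ x : ℝ) : ℝ :=
  sSup ((fun α : ℝ => greenTwo α δ x) '' Ioc (δ - 1) 0)

/-!
A Green function with pole at infinity is unique by the maximum principle. For the complement of
finitely many real intervals it exists as the real part of a primitive of `n / ∏ √(z - e)`, where
`e` runs over the end points: the primitive lives on the upper half-plane, its real part is
reflected across the real line, and the real zero of `n` in the gap is chosen so that the integral
over the gap vanishes. With `t = α - δ cos φ`, the value of `G_{α,δ}` at the point of the gap with
angle `θ` is the integral over `[θ, π]` of a density that is smooth in `α` and `φ`.

Differentiating under the integral, `∂_α G` is strictly increasing along the gap, negative near its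
left end and positive near its right end, hence has exactly one zero. A maximum of
`α ↦ G_{α,δ}(x₀)` at an interior point is a critical point. At the end point `α = 0` the one-sided
condition `0 ≤ ∂_α G(x₀)` suffices, because `∂_α G` is increasing in `x` and vanishes at `x = 0` by
symmetry. As `α → δ - 1` the mass of the weight `1 / √(1 - t ^ 2)` concentrates at the left end of
the gap, the zero of `n` tends to `-1`, and `G_{α,δ}(x₀) → G_δ(x₀)`. So the supremum over the
half-open interval is either attained or equal to this limit.
-/

/-! ### Uniqueness of the Green function -/

lemma eventually_eq_of_isLocalMax_of_harmonicAt {v : ℂ → ℝ} {z : ℂ}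
    (hv : InnerProductSpace.HarmonicAt v z) (hmax : IsLocalMax v z) :
    ∀ᶠ y in 𝓝 z, v y = v z := by
  obtain ⟨R, hR, hharm⟩ := Metric.eventually_nhds_iff_ball.1 hv.eventually
  obtain ⟨F, hF, hFv⟩ :=
    InnerProductSpace.HarmonicOnNhd.exists_analyticOnNhd_ball_re_eq (f := v) hharm
  have hball : Metric.ball z R ∈ 𝓝 z := Metric.ball_mem_nhds z hR
  -- The maximum modulus principle applies to `exp ∘ F`, whose modulus is `exp v`.
  have hnorm : ∀ y ∈ Metric.ball z R, ‖Complex.exp (F y)‖ = Real.exp (v y) := fun y hy => by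
    rw [Complex.norm_exp]
    exact congrArg Real.exp (hFv hy)
  have hnorm_z := hnorm z (Metric.mem_ball_self hR)
  have hdiff : ∀ᶠ y in 𝓝 z, DifferentiableAt ℂ (fun y => Complex.exp (F y)) y := by
    filter_upwards [hball] with y hy
    exact (hF y hy).differentiableAt.cexp
  have hmax_norm : IsLocalMax (norm ∘ fun y => Complex.exp (F y)) z := by
    filter_upwards [hball, hmax] with y hy hle
    rw [Function.comp_apply, Function.comp_apply, hnorm y hy, hnorm_z]
    exact Real.exp_le_exp.2 hle
  filter_upwards [hball, Complex.eventually_eq_of_isLocalMax_norm hdiff hmax_norm] with y hy heq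
  exact Real.exp_injective <| by rw [← hnorm y hy, ← hnorm_z, heq]

lemma nonpos_of_harmonicOnNhd_compl {E : Set ℂ} (hE : E.Nonempty) {v : ℂ → ℝ}
    (hv : InnerProductSpace.HarmonicOnNhd v Eᶜ) (hc : Continuous v) (hvE : ∀ z ∈ E, v z ≤ 0)
    (hbot : Tendsto v (Bornology.cobounded ℂ) atBot) (z : ℂ) : v z ≤ 0 := by
  obtain ⟨m, hm⟩ : ∃ m, ∀ y, v y ≤ v m :=
    hc.exists_forall_ge (by rwa [← Metric.cobounded_eq_cocompact])
  suffices ∃ y ∈ E, v y = v m by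
    obtain ⟨y, hyE, hy⟩ := this
    exact (hm z).trans (hy.symm.le.trans (hvE y hyE))
  by_contra! hdisj
  have hopen : IsOpen {y | v y = v m} := isOpen_iff_mem_nhds.2 fun y (hy : v y = v m) => by
    filter_upwards [eventually_eq_of_isLocalMax_of_harmonicAt (hv y fun hyE => hdisj y hyE hy)
      (Eventually.of_forall fun w => (hm w).trans hy.ge)] with w hw
    exact hw.trans hy
  have huniv : {y | v y = v m} = univ :=
    IsClopen.eq_univ ⟨isClosed_eq hc continuous_const, hopen⟩ ⟨m, rfl⟩
  obtain ⟨e, he⟩ := hE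
  exact hdisj e he (huniv.ge (mem_univ e))

namespace IsGreenAtInfty

variable {E : Set ℂ} {g g₁ g₂ : ℂ → ℝ}

lemma tendsto_cobounded_atTop (hg : IsGreenAtInfty E g) :
    Tendsto g (Bornology.cobounded ℂ) atTop := by
  obtain ⟨C, hC⟩ := hg.log_pole.bound
  have hlog : Tendsto (fun z : ℂ => Real.log ‖z‖ - C) (Bornology.cobounded ℂ) atTop :=
    tendsto_atTop_add_const_right _ _ (Real.tendsto_log_atTop.comp tendsto_norm_cobounded_atTop)
  refine tendsto_atTop_mono' _ ?_ hlog
  filter_upwards [hC] with z hz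
  rw [norm_one, mul_one, Real.norm_eq_abs] at hz
  linarith [neg_le_of_abs_le hz]

/-- Subtracting `ε • g₁` forces the difference `g₁ - g₂`, which is only bounded near infinity, to
tend to `-∞` there, so that the maximum principle applies. -/
lemma sub_le_mul (hE : E.Nonempty) (h₁ : IsGreenAtInfty E g₁) (h₂ : IsGreenAtInfty E g₂)
    {ε : ℝ} (hε : 0 < ε) (z : ℂ) : g₁ z - g₂ z ≤ ε * g₁ z := by
  have hbot : Tendsto (g₁ - g₂ - ε • g₁) (Bornology.cobounded ℂ) atBot := by
    obtain ⟨C, hC⟩ := (h₁.log_pole.sub h₂.log_pole).bound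
    have hmajor : Tendsto (fun z => C + -ε * g₁ z) (Bornology.cobounded ℂ) atBot :=
      tendsto_atBot_add_const_left _ _
        (h₁.tendsto_cobounded_atTop.const_mul_atTop_of_neg (neg_lt_zero.2 hε))
    refine tendsto_atBot_mono' _ ?_ hmajor
    filter_upwards [hC] with w hw
    rw [sub_sub_sub_cancel_right, norm_one, mul_one, Real.norm_eq_abs] at hw
    simp only [Pi.sub_apply, Pi.smul_apply, smul_eq_mul]
    linarith [le_of_abs_le hw]
  have hnonpos := nonpos_of_harmonicOnNhd_compl hE
    ((h₁.harmonic.sub h₂.harmonic).sub h₁.harmonic.const_smul)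
    ((h₁.continuous.sub h₂.continuous).sub (h₁.continuous.const_smul ε))
    (fun w hw => by simp [h₁.eq_zero w hw, h₂.eq_zero w hw]) hbot z
  simpa only [Pi.sub_apply, Pi.smul_apply, smul_eq_mul, sub_nonpos] using hnonpos

lemma le (hE : E.Nonempty) (h₁ : IsGreenAtInfty E g₁) (h₂ : IsGreenAtInfty E g₂) (z : ℂ) :
    g₁ z ≤ g₂ z := by
  have hlim : Tendsto (fun ε : ℝ => ε * g₁ z) (𝓝[>] 0) (𝓝 0) := by
    have := (continuous_mul_const (g₁ z)).tendsto' 0 0 (zero_mul _)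
    exact this.mono_left nhdsWithin_le_nhds
  have hle := ge_of_tendsto hlim <|
    eventually_mem_nhdsWithin.mono fun _ hε => sub_le_mul hE h₁ h₂ hε z
  exact sub_nonpos.1 hle

lemma greenAtInfty_eq (hE : E.Nonempty) (hg : IsGreenAtInfty E g) : greenAtInfty E = g := by
  have hex : ∃ g, IsGreenAtInfty E g := ⟨g, hg⟩
  rw [greenAtInfty, dif_pos hex]
  exact funext fun z => le_antisymm (hex.choose_spec.le hE hg z) (hg.le hE hex.choose_spec z)

end IsGreenAtInfty

/-! ### The square root on the closed upper half-plane -/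

/-- The branch of the square root that is holomorphic off the half-line `-i [0, ∞)` and maps the
closed upper half-plane onto the closed first quadrant. The branch cut of `Complex.sqrt` is turned
away from the real line, so that quotients of these roots extend holomorphically across it. -/
noncomputable def upperSqrt (z : ℂ) : ℂ :=
  Complex.sqrt Complex.I * Complex.sqrt (-Complex.I * z)

section UpperSqrt

variable {z : ℂ}

lemma upperSqrt_sq (z : ℂ) : upperSqrt z ^ 2 = z := by
  have hsq (w : ℂ) : Complex.sqrt w ^ 2 = w := Complex.cpow_ofNat_inv_pow w 2
  rw [upperSqrt, mul_pow, hsq, hsq, ← mul_assoc, mul_neg, Complex.I_mul_I, neg_neg, one_mul]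

@[simp]
lemma upperSqrt_zero : upperSqrt 0 = 0 := by
  rw [upperSqrt, mul_zero, Complex.sqrt_zero, mul_zero]

lemma upperSqrt_ne_zero (hz : z ≠ 0) : upperSqrt z ≠ 0 := fun h =>
  hz <| by rw [← upperSqrt_sq z, h, zero_pow two_ne_zero]

lemma norm_upperSqrt (z : ℂ) : ‖upperSqrt z‖ = √‖z‖ := by
  rw [← Real.sqrt_sq (norm_nonneg (upperSqrt z)), ← norm_pow, upperSqrt_sq]

lemma hasDerivAt_upperSqrt (hz : 0 < z.im ∨ z.re ≠ 0) :
    HasDerivAt upperSqrt (1 / (2 * upperSqrt z)) z := by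
  have hslit : -Complex.I * z ∈ Complex.slitPlane := by
    simpa [Complex.mem_slitPlane_iff] using hz
  have hd : HasDerivAt upperSqrt (deriv upperSqrt z) z :=
    DifferentiableAt.hasDerivAt <|
      ((Complex.differentiableAt_sqrt hslit).comp z
        (differentiableAt_id.const_mul (-Complex.I))).const_mul _
  have hsq : HasDerivAt (upperSqrt ^ 2) 1 z := by
    rw [show upperSqrt ^ 2 = id from funext upperSqrt_sq]
    exact hasDerivAt_id z
  have hderiv : 2 * upperSqrt z * deriv upperSqrt z = 1 := by
    simpa only [Nat.cast_ofNat, Nat.add_one_sub_one, pow_one] using (hd.pow 2).unique hsq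
  rwa [one_div, inv_eq_of_mul_eq_one_right hderiv]

lemma continuousAt_upperSqrt (hz : 0 ≤ z.im) : ContinuousAt upperSqrt z := by
  by_cases h : 0 < z.im ∨ z.re ≠ 0
  · exact (hasDerivAt_upperSqrt h).continuousAt
  · push Not at h
    obtain rfl : z = 0 := Complex.ext h.2 (le_antisymm h.1 hz)
    rw [ContinuousAt, upperSqrt_zero, tendsto_zero_iff_norm_tendsto_zero]
    simp only [norm_upperSqrt]
    exact continuous_norm.sqrt.tendsto' 0 0 (by simp)

lemma upperSqrt_mem_first_quadrant (hz : 0 ≤ z.im) :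
    0 ≤ (upperSqrt z).re ∧ 0 ≤ (upperSqrt z).im := by
  set p := Complex.sqrt (-Complex.I * z) with hp
  have hp_sq : p ^ 2 = -Complex.I * z := Complex.cpow_ofNat_inv_pow _ 2
  have hp_re : 0 ≤ p.re := by
    rw [hp, Complex.sqrt, Complex.cpow_inv_two_re]
    exact Real.sqrt_nonneg _
  have hre_sq : p.re ^ 2 - p.im ^ 2 = z.im := by
    simpa [sq] using congrArg Complex.re hp_sq
  have him : |p.im| ≤ p.re := abs_le_of_sq_le_sq (by linarith) hp_re
  have hroot : upperSqrt z = ((√2⁻¹ : ℝ) : ℂ) * ((1 + Complex.I) * p) := by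
    rw [upperSqrt, Complex.sqrt_I, mul_assoc]
  rw [hroot, Complex.re_ofReal_mul, Complex.im_ofReal_mul]
  constructor <;> refine mul_nonneg (Real.sqrt_nonneg _) ?_ <;>
    simp only [Complex.mul_re, Complex.mul_im, Complex.add_re, Complex.add_im, Complex.one_re,
      Complex.one_im, Complex.I_re, Complex.I_im] <;> linarith [abs_le.1 him]

lemma upperSqrt_eq_of_sq_eq {w : ℂ} (hz : 0 ≤ z.im) (hw : w ^ 2 = z) (hre : 0 ≤ w.re)
    (him : 0 ≤ w.im) : upperSqrt z = w := by
  obtain ⟨hre', him'⟩ := upperSqrt_mem_first_quadrant hz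
  rcases sq_eq_sq_iff_eq_or_eq_neg.1 ((upperSqrt_sq z).trans hw.symm) with h | h
  · exact h
  · rw [h, Complex.neg_re] at hre'
    rw [h, Complex.neg_im] at him'
    obtain rfl : w = 0 := Complex.ext (by simp; linarith) (by simp; linarith)
    rw [h, neg_zero]

lemma upperSqrt_ofReal_of_nonneg {x : ℝ} (hx : 0 ≤ x) : upperSqrt x = (√x : ℝ) :=
  upperSqrt_eq_of_sq_eq (by simp) (by rw [← Complex.ofReal_pow, Real.sq_sqrt hx])
    (Real.sqrt_nonneg x) (by simp)

lemma upperSqrt_ofReal_of_nonpos {x : ℝ} (hx : x ≤ 0) :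
    upperSqrt x = Complex.I * (√(-x) : ℝ) := by
  refine upperSqrt_eq_of_sq_eq (by simp) ?_ (by simp) (by simp)
  rw [mul_pow, Complex.I_sq, ← Complex.ofReal_pow, Real.sq_sqrt (neg_nonneg.2 hx),
    Complex.ofReal_neg, neg_one_mul, neg_neg]

end UpperSqrt

/-! ### Primitives on the upper half-plane -/

open UpperHalfPlane (upperHalfPlaneSet isOpen_upperHalfPlaneSet)

lemma isExactOn_of_isExactOn_comp_mul_deriv {U V : Set ℂ} (hU : IsOpen U) (hV : IsOpen V)
    {f φ ψ : ℂ → ℂ} (hφ : DifferentiableOn ℂ φ U) (hψ : DifferentiableOn ℂ ψ V)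
    (hmaps : MapsTo ψ V U) (hinv : LeftInvOn φ ψ V)
    (hf : Complex.IsExactOn (fun ζ => f (φ ζ) * deriv φ ζ) U) : Complex.IsExactOn f V := by
  obtain ⟨Ψ, hΨ⟩ := hf
  refine ⟨Ψ ∘ ψ, fun z hz => ?_⟩
  have hψz := (hψ.differentiableAt (hV.mem_nhds hz)).hasDerivAt
  have hφz := (hφ.differentiableAt (hU.mem_nhds (hmaps hz))).hasDerivAt
  have hcomp : HasDerivAt (φ ∘ ψ) 1 z := (hasDerivAt_id z).congr_of_eventuallyEq <| by
    filter_upwards [hV.mem_nhds hz] with w hw using hinv hw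
  have hone : deriv φ (ψ z) * deriv ψ z = 1 := (hφz.comp z hψz).unique hcomp
  simpa only [hinv hz, mul_assoc, hone, mul_one] using (hΨ _ (hmaps hz)).comp z hψz

lemma one_sub_ne_zero_of_mem_ball {ζ : ℂ} (hζ : ζ ∈ Metric.ball 0 1) : 1 - ζ ≠ 0 := by
  intro h
  rw [← sub_eq_zero.1 h] at hζ
  simp at hζ

lemma mapsTo_cayley_ball_upperHalfPlane :
    MapsTo (fun ζ : ℂ => Complex.I * (1 + ζ) / (1 - ζ)) (Metric.ball 0 1) upperHalfPlaneSet := by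
  intro ζ hζ
  have hnormSq : Complex.normSq ζ < 1 := by
    rw [Complex.normSq_eq_norm_sq]
    exact pow_lt_one₀ (norm_nonneg ζ) (mem_ball_zero_iff.1 hζ) two_ne_zero
  have him : (Complex.I * (1 + ζ) / (1 - ζ)).im
      = (1 - Complex.normSq ζ) / Complex.normSq (1 - ζ) := by
    rw [Complex.div_im, Complex.normSq_apply ζ, ← sub_div]
    simp only [Complex.mul_re, Complex.mul_im, Complex.add_re, Complex.add_im, Complex.sub_re,
      Complex.sub_im, Complex.one_re, Complex.one_im, Complex.I_re, Complex.I_im]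
    ring
  change 0 < (Complex.I * (1 + ζ) / (1 - ζ)).im
  rw [him]
  exact div_pos (sub_pos.2 hnormSq) (Complex.normSq_pos.2 (one_sub_ne_zero_of_mem_ball hζ))

lemma add_I_ne_zero_of_im_pos {z : ℂ} (hz : 0 < z.im) : z + Complex.I ≠ 0 := fun h => by
  have := congrArg Complex.im h
  rw [Complex.add_im, Complex.I_im, Complex.zero_im] at this
  linarith

lemma mapsTo_cayley_upperHalfPlane_ball :
    MapsTo (fun z : ℂ => (z - Complex.I) / (z + Complex.I)) upperHalfPlaneSet
      (Metric.ball 0 1) := by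
  intro z (hz : 0 < z.im)
  rw [mem_ball_zero_iff, norm_div, div_lt_one (norm_pos_iff.2 (add_I_ne_zero_of_im_pos hz)),
    ← sq_lt_sq₀ (norm_nonneg _) (norm_nonneg _), ← Complex.normSq_eq_norm_sq,
    ← Complex.normSq_eq_norm_sq, Complex.normSq_apply, Complex.normSq_apply]
  simp only [Complex.add_re, Complex.add_im, Complex.sub_re, Complex.sub_im, Complex.I_re,
    Complex.I_im]
  linarith

lemma isExactOn_upperHalfPlane {f : ℂ → ℂ} (hf : DifferentiableOn ℂ f upperHalfPlaneSet) :
    Complex.IsExactOn f upperHalfPlaneSet := by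
  have hφ : DifferentiableOn ℂ (fun ζ : ℂ => Complex.I * (1 + ζ) / (1 - ζ)) (Metric.ball 0 1) :=
    .div (by fun_prop) (by fun_prop) fun ζ hζ => one_sub_ne_zero_of_mem_ball hζ
  refine isExactOn_of_isExactOn_comp_mul_deriv Metric.isOpen_ball isOpen_upperHalfPlaneSet hφ
    (.div (by fun_prop) (by fun_prop) fun z hz => add_I_ne_zero_of_im_pos hz)
    mapsTo_cayley_upperHalfPlane_ball (fun z hz => ?_)
    ((hf.comp hφ mapsTo_cayley_ball_upperHalfPlane).mul
      (hφ.deriv Metric.isOpen_ball)).isExactOn_ball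
  have hz' := add_I_ne_zero_of_im_pos hz
  have hone : 1 - (z - Complex.I) / (z + Complex.I) = 2 * Complex.I / (z + Complex.I) := by
    field_simp
    ring
  simp only [Pi.div_apply, hone]
  field_simp
  ring

/-- `F` is a primitive of `f` on the open upper half-plane that is continuous up to the real
line. -/
structure IsUpperPrimitive (F f : ℂ → ℂ) : Prop where
  hasDerivAt : ∀ z : ℂ, 0 < z.im → HasDerivAt F (f z) z
  continuousOn : ContinuousOn F {z : ℂ | 0 ≤ z.im}

lemma exists_eq_add_const_of_hasDerivAt {s : Set ℂ} (hs : IsOpen s) (hs' : IsPreconnected s)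
    {F Φ f : ℂ → ℂ} (hF : ∀ z ∈ s, HasDerivAt F (f z) z) (hΦ : ∀ z ∈ s, HasDerivAt Φ (f z) z) :
    ∃ k, ∀ z ∈ s, F z = Φ z + k := by
  have hsub : ∀ z ∈ s, HasDerivAt (fun z => F z - Φ z) 0 z := fun z hz => by
    simpa only [sub_self] using! (hF z hz).sub (hΦ z hz)
  obtain ⟨k, hk⟩ := hs.exists_is_const_of_deriv_eq_zero hs'
    (fun z hz => (hsub z hz).differentiableAt.differentiableWithinAt) fun z hz => (hsub z hz).deriv
  exact ⟨k, fun z hz => sub_eq_iff_eq_add'.1 (hk z hz)⟩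

lemma isOpen_ball_inter_upperHalfPlane (x : ℂ) (ε : ℝ) :
    IsOpen (Metric.ball x ε ∩ upperHalfPlaneSet) :=
  Metric.isOpen_ball.inter isOpen_upperHalfPlaneSet

lemma convex_ball_inter_upperHalfPlane (x : ℂ) (ε : ℝ) :
    Convex ℝ (Metric.ball x ε ∩ upperHalfPlaneSet) :=
  (convex_ball x ε).inter (convex_halfSpace_im_gt 0)

lemma neBot_nhdsWithin_upperHalfPlane {z : ℂ} (hz : 0 ≤ z.im) : (𝓝[upperHalfPlaneSet] z).NeBot :=
  mem_closure_iff_nhdsWithin_neBot.1 <| by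
    rwa [upperHalfPlaneSet, Complex.closure_setOfPred_lt_im]

lemma exists_isUpperPrimitive {f : ℂ → ℂ} (hf : DifferentiableOn ℂ f upperHalfPlaneSet)
    (hloc : ∀ x : ℝ, ∃ ε > 0, ∃ Φ : ℂ → ℂ, ContinuousAt Φ x ∧
      ∀ z ∈ Metric.ball (x : ℂ) ε, 0 < z.im → HasDerivAt Φ (f z) z) :
    ∃ F, IsUpperPrimitive F f := by
  obtain ⟨F, hF⟩ := isExactOn_upperHalfPlane hf
  have hlim : ∀ z : ℂ, 0 ≤ z.im → ∃ y, Tendsto F (𝓝[upperHalfPlaneSet] z) (𝓝 y) := by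
    intro z hz
    rcases hz.eq_or_lt with hreal | hpos
    · obtain ⟨x, rfl⟩ : ∃ x : ℝ, (x : ℂ) = z := ⟨z.re, Complex.ext rfl hreal⟩
      obtain ⟨ε, hε, Φ, hΦ, hΦ'⟩ := hloc x
      obtain ⟨k, hk⟩ := exists_eq_add_const_of_hasDerivAt (isOpen_ball_inter_upperHalfPlane x ε)
        (convex_ball_inter_upperHalfPlane x ε).isPreconnected
        (fun w hw => hF w hw.2) fun w hw => hΦ' w hw.1 hw.2
      refine ⟨Φ x + k, ((hΦ.tendsto.add_const k).mono_left nhdsWithin_le_nhds).congr' ?_⟩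
      filter_upwards [self_mem_nhdsWithin, mem_nhdsWithin_of_mem_nhds (Metric.ball_mem_nhds _ hε)]
        with w hwU hwε using (hk w ⟨hwε, hwU⟩).symm
    · exact ⟨F z, (hF z hpos).continuousAt.tendsto.mono_left nhdsWithin_le_nhds⟩
  refine ⟨extendFrom upperHalfPlaneSet F, ⟨fun z hz => ?_, ?_⟩⟩
  · refine (hF z hz).congr_of_eventuallyEq ?_
    filter_upwards [isOpen_upperHalfPlaneSet.mem_nhds hz] with w hw
    exact extendFrom_eq (subset_closure hw)
      ((hF w hw).continuousAt.tendsto.mono_left nhdsWithin_le_nhds)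
  · exact continuousOn_extendFrom (Complex.closure_setOfPred_lt_im 0).ge hlim

/-! ### Entire functions divided by products of square roots -/

/-- The function `n z / ∏ √(z - e)`, the product being over the branch points `e ∈ S`; the complex
derivatives of the Green functions considered here are of this form. -/
noncomputable def branchQuot (n : ℂ → ℂ) (S : Finset ℝ) (z : ℂ) : ℂ :=
  n z / ∏ e ∈ S, upperSqrt (z - e)

section BranchQuot

variable {n : ℂ → ℂ} {S : Finset ℝ}

lemma differentiableAt_branchQuot (hn : Differentiable ℂ n) {z : ℂ}
    (hz : ∀ e ∈ S, 0 < z.im ∨ z.re ≠ e) : DifferentiableAt ℂ (branchQuot n S) z := by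
  have hz' : ∀ e ∈ S, 0 < (z - e).im ∨ (z - e).re ≠ 0 := fun e he => by
    simpa [sub_ne_zero] using hz e he
  refine (hn z).div (DifferentiableAt.fun_finsetProd fun e he => ?_)
    (Finset.prod_ne_zero_iff.2 fun e he => upperSqrt_ne_zero fun h => ?_)
  · exact (HasDerivAt.comp_sub_const z (e : ℂ) (hasDerivAt_upperSqrt (hz' e he))).differentiableAt
  · simpa [h] using hz' e he

lemma analyticAt_branchQuot (hn : Differentiable ℂ n) {x : ℝ} (hx : x ∉ S) :
    AnalyticAt ℂ (branchQuot n S) x := by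
  rw [Complex.analyticAt_iff_eventually_differentiableAt]
  have hne : ∀ᶠ z : ℂ in 𝓝 (x : ℂ), z.re ∉ S :=
    Complex.continuous_re.continuousAt.eventually
      (S.finite_toSet.isClosed.isOpen_compl.mem_nhds (by simpa using hx))
  filter_upwards [hne] with z hz
  exact differentiableAt_branchQuot hn fun e he => Or.inr fun h => hz (h ▸ he)

/-- In the coordinate `ζ = √(z - x)` the form `g z dz / √(z - x)` is the regular form
`2 g (x + ζ ^ 2) dζ`. -/
lemma exists_primitive_div_upperSqrt {g : ℂ → ℂ} {x : ℝ} (hg : AnalyticAt ℂ g x) :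
    ∃ ε > 0, ∃ Φ : ℂ → ℂ, ContinuousAt Φ x ∧
      ∀ z ∈ Metric.ball (x : ℂ) ε, 0 < z.im → HasDerivAt Φ (g z / upperSqrt (z - x)) z := by
  obtain ⟨ε, hε, hgε⟩ := hg.exists_ball_analyticOnNhd
  have hmaps : MapsTo (fun ζ : ℂ => x + ζ ^ 2) (Metric.ball 0 √ε) (Metric.ball x ε) := by
    intro ζ hζ
    rw [mem_ball_zero_iff, Real.lt_sqrt (norm_nonneg _)] at hζ
    simpa using hζ
  obtain ⟨Ψ, hΨ⟩ : Complex.IsExactOn (fun ζ => 2 * g (x + ζ ^ 2)) (Metric.ball 0 √ε) :=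
    ((hgε.differentiableOn.comp (by fun_prop) hmaps).const_mul 2).isExactOn_ball
  have hball : ∀ z ∈ Metric.ball (x : ℂ) ε, upperSqrt (z - x) ∈ Metric.ball (0 : ℂ) √ε := by
    intro z hz
    rw [mem_ball_zero_iff, norm_upperSqrt, ← dist_eq_norm]
    exact Real.sqrt_lt_sqrt dist_nonneg hz
  refine ⟨ε, hε, fun z => Ψ (upperSqrt (z - x)), ?_, fun z hz him => ?_⟩
  · have hroot : ContinuousAt (fun z : ℂ => upperSqrt (z - x)) x :=
      ContinuousAt.comp (f := fun z : ℂ => z - (x : ℂ)) (continuousAt_upperSqrt (by simp))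
        (by fun_prop)
    exact ContinuousAt.comp (f := fun z : ℂ => upperSqrt (z - x))
      (hΨ _ (hball x (Metric.mem_ball_self hε))).continuousAt hroot
  · have hroot : HasDerivAt (fun w : ℂ => upperSqrt (w - x)) (1 / (2 * upperSqrt (z - x))) z :=
      HasDerivAt.comp_sub_const z (x : ℂ) (hasDerivAt_upperSqrt (Or.inl (by simpa)))
    convert! (hΨ _ (hball z hz)).comp z hroot using 1
    beta_reduce
    rw [upperSqrt_sq, add_sub_cancel, mul_one_div, mul_div_mul_left _ _ two_ne_zero]

lemma branchQuot_eq_branchQuot_erase_div (n : ℂ → ℂ) {e : ℝ} (he : e ∈ S) (z : ℂ) :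
    branchQuot n S z = branchQuot n (S.erase e) z / upperSqrt (z - e) := by
  rw [branchQuot, branchQuot, div_div, mul_comm,
    Finset.mul_prod_erase S (fun e => upperSqrt (z - e)) he]

lemma exists_isUpperPrimitive_branchQuot (hn : Differentiable ℂ n) (S : Finset ℝ) :
    ∃ F, IsUpperPrimitive F (branchQuot n S) := by
  refine exists_isUpperPrimitive (fun z hz => (differentiableAt_branchQuot hn fun e _ =>
    Or.inl hz).differentiableWithinAt) fun x => ?_
  by_cases hx : x ∈ S
  · simpa only [branchQuot_eq_branchQuot_erase_div n hx] using
      exists_primitive_div_upperSqrt (analyticAt_branchQuot hn (S.notMem_erase x))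
  · obtain ⟨ε, hε, hf⟩ := (analyticAt_branchQuot hn hx).exists_ball_analyticOnNhd
    obtain ⟨Φ, hΦ⟩ := hf.differentiableOn.isExactOn_ball
    exact ⟨ε, hε, Φ, (hΦ x (Metric.mem_ball_self hε)).continuousAt, fun z hz _ => hΦ z hz⟩

end BranchQuot

/-! ### Reflection across the real line -/

open ComplexConjugate

lemma conj_mem_ball_ofReal {x ε : ℝ} {z : ℂ} (hz : z ∈ Metric.ball (x : ℂ) ε) :
    conj z ∈ Metric.ball (x : ℂ) ε := by
  rwa [Metric.mem_ball, ← Complex.conj_ofReal x, Complex.dist_conj_conj]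

lemma eqOn_conj_comp_conj {f : ℂ → ℂ} {x ε : ℝ} (hε : 0 < ε)
    (hf : DifferentiableOn ℂ f (Metric.ball (x : ℂ) ε))
    (hreal : ∀ᶠ y : ℝ in 𝓝 x, (f y).im = 0) :
    EqOn f (conj ∘ f ∘ conj) (Metric.ball (x : ℂ) ε) := by
  have hf' : DifferentiableOn ℂ (conj ∘ f ∘ conj) (Metric.ball (x : ℂ) ε) := fun z hz => by
    have hdiff := hf.differentiableAt (Metric.isOpen_ball.mem_nhds (conj_mem_ball_ofReal hz))
    simpa only [Complex.conj_conj]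
      using hdiff.hasDerivAt.conj_conj.differentiableAt.differentiableWithinAt
  refine (hf.analyticOnNhd Metric.isOpen_ball).eqOn_of_preconnected_of_frequently_eq
    (hf'.analyticOnNhd Metric.isOpen_ball) (convex_ball _ _).isPreconnected
    (Metric.mem_ball_self hε) ?_
  have hmap : Tendsto (fun y : ℝ => (y : ℂ)) (𝓝[≠] x) (𝓝[≠] (x : ℂ)) :=
    Complex.continuous_ofReal.continuousWithinAt.tendsto_nhdsWithin
      fun y hy => Complex.ofReal_injective.ne hy
  refine hmap.frequently (Eventually.frequently ?_)
  filter_upwards [hreal.filter_mono nhdsWithin_le_nhds] with y hy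
  simp only [Function.comp_apply, Complex.conj_ofReal]
  exact (Complex.conj_eq_iff_im.2 hy).symm

lemma re_conj_eq_re_of_hasDerivAt {Φ f : ℂ → ℂ} {x ε : ℝ}
    (hΦ : ∀ z ∈ Metric.ball (x : ℂ) ε, HasDerivAt Φ (f z) z)
    (hreal : ∀ᶠ y : ℝ in 𝓝 x, (f y).im = 0) {z : ℂ} (hz : z ∈ Metric.ball (x : ℂ) ε) :
    (Φ (conj z)).re = (Φ z).re := by
  have hε : 0 < ε := Metric.nonempty_ball.1 ⟨z, hz⟩
  have hfeq := eqOn_conj_comp_conj hε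
    (Complex.IsExactOn.differentiableOn Metric.isOpen_ball ⟨Φ, hΦ⟩) hreal
  have hΦ' : ∀ w ∈ Metric.ball (x : ℂ) ε, HasDerivAt (conj ∘ Φ ∘ conj) (f w) w := by
    intro w hw
    rw [hfeq hw]
    simpa only [Complex.conj_conj, Function.comp_apply] using!
      (hΦ _ (conj_mem_ball_ofReal hw)).conj_conj
  obtain ⟨k, hk⟩ := exists_eq_add_const_of_hasDerivAt Metric.isOpen_ball
    (convex_ball (x : ℂ) ε).isPreconnected hΦ hΦ'
  have hre : ∀ w ∈ Metric.ball (x : ℂ) ε, (Φ w).re = (Φ (conj w)).re + k.re := fun w hw => by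
    simpa only [Function.comp_apply, Complex.add_re, Complex.conj_re]
      using congrArg Complex.re (hk w hw)
  have hx := hre x (Metric.mem_ball_self hε)
  rw [Complex.conj_ofReal] at hx
  linarith [hre z hz]

/-- The extension of the real part of `F` from the upper half-plane to a function on `ℂ` that is
invariant under complex conjugation. -/
noncomputable def reflectRe (F : ℂ → ℂ) (z : ℂ) : ℝ := (F ⟨z.re, |z.im|⟩).re

section ReflectRe

variable {F f : ℂ → ℂ} {z : ℂ}

lemma reflectRe_of_nonneg (hz : 0 ≤ z.im) : reflectRe F z = (F z).re := by
  rw [reflectRe, abs_of_nonneg hz]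

lemma reflectRe_conj (F : ℂ → ℂ) (z : ℂ) : reflectRe F (conj z) = reflectRe F z := by
  rw [reflectRe, reflectRe, Complex.conj_re, Complex.conj_im, abs_neg]

lemma reflectRe_of_nonpos (hz : z.im ≤ 0) : reflectRe F z = (F (conj z)).re := by
  rw [← reflectRe_conj, reflectRe_of_nonneg (by simpa)]

lemma reflectRe_ofReal (F : ℂ → ℂ) (x : ℝ) : reflectRe F x = (F x).re :=
  reflectRe_of_nonneg (Complex.ofReal_im x).ge

lemma continuous_reflectRe (hF : ContinuousOn F {z : ℂ | 0 ≤ z.im}) :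
    Continuous (reflectRe F) := by
  have hfold : Continuous fun z : ℂ => (⟨z.re, |z.im|⟩ : ℂ) := by
    have : Continuous fun z : ℂ => Complex.equivRealProdCLM.symm (z.re, |z.im|) := by fun_prop
    exact this
  exact Complex.continuous_re.comp (hF.comp_continuous hfold fun z => abs_nonneg z.im)

namespace IsUpperPrimitive

lemma analyticAt (hF : IsUpperPrimitive F f) (hz : 0 < z.im) : AnalyticAt ℂ F z :=
  DifferentiableOn.analyticAt
    (fun w hw => (hF.hasDerivAt w hw).differentiableAt.differentiableWithinAt)
    (isOpen_upperHalfPlaneSet.mem_nhds hz)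

lemma exists_local_extension (hF : IsUpperPrimitive F f) {x : ℝ} (hf : AnalyticAt ℂ f x) :
    ∃ ε > 0, ∃ Φ : ℂ → ℂ, (∀ z ∈ Metric.ball (x : ℂ) ε, HasDerivAt Φ (f z) z) ∧
      ∀ z ∈ Metric.ball (x : ℂ) ε, 0 ≤ z.im → F z = Φ z := by
  obtain ⟨ε, hε, hfε⟩ := hf.exists_ball_analyticOnNhd
  obtain ⟨Φ, hΦ⟩ := hfε.differentiableOn.isExactOn_ball
  obtain ⟨k, hk⟩ := exists_eq_add_const_of_hasDerivAt (isOpen_ball_inter_upperHalfPlane x ε)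
    (convex_ball_inter_upperHalfPlane x ε).isPreconnected
    (fun w hw => hF.hasDerivAt w hw.2) fun w hw => hΦ w hw.1
  refine ⟨ε, hε, fun z => Φ z + k, fun z hz => (hΦ z hz).add_const k, fun z hz him => ?_⟩
  have := neBot_nhdsWithin_upperHalfPlane him
  have hFlim : Tendsto F (𝓝[upperHalfPlaneSet] z) (𝓝 (F z)) :=
    (hF.continuousOn z him).mono_left (nhdsWithin_mono _ fun w (hw : 0 < w.im) => hw.le)
  have hΦlim : Tendsto (fun w => Φ w + k) (𝓝[upperHalfPlaneSet] z) (𝓝 (Φ z + k)) :=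
    ((hΦ z hz).continuousAt.tendsto.add_const k).mono_left nhdsWithin_le_nhds
  refine tendsto_nhds_unique_of_eventuallyEq hFlim hΦlim ?_
  filter_upwards [self_mem_nhdsWithin,
    mem_nhdsWithin_of_mem_nhds (Metric.isOpen_ball.mem_nhds hz)] with w hw hw'
  exact hk w ⟨hw', hw⟩

lemma hasDerivAt_re_ofReal (hF : IsUpperPrimitive F f) {x : ℝ} (hf : AnalyticAt ℂ f x) :
    HasDerivAt (fun y : ℝ => (F y).re) (f x).re x := by
  obtain ⟨ε, hε, Φ, hΦ, hFΦ⟩ := hF.exists_local_extension hf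
  refine (hΦ x (Metric.mem_ball_self hε)).real_of_complex.congr_of_eventuallyEq ?_
  filter_upwards [Complex.continuous_ofReal.continuousAt.eventually
    (Metric.ball_mem_nhds (x : ℂ) hε)] with y hy
  rw [hFΦ y hy (Complex.ofReal_im y).ge]

lemma harmonicAt_reflectRe_of_im_pos (hF : IsUpperPrimitive F f) (hz : 0 < z.im) :
    InnerProductSpace.HarmonicAt (reflectRe F) z := by
  refine (InnerProductSpace.harmonicAt_congr_nhds ?_).2 (hF.analyticAt hz).harmonicAt_re
  filter_upwards [isOpen_upperHalfPlaneSet.mem_nhds hz] with w hw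
  exact reflectRe_of_nonneg (le_of_lt hw)

lemma harmonicAt_reflectRe_of_im_neg (hF : IsUpperPrimitive F f) (hz : z.im < 0) :
    InnerProductSpace.HarmonicAt (reflectRe F) z := by
  have hU : {w : ℂ | w.im < 0} ∈ 𝓝 z :=
    (isOpen_lt Complex.continuous_im continuous_const).mem_nhds hz
  have han : AnalyticAt ℂ (conj ∘ F ∘ conj) z := by
    refine DifferentiableOn.analyticAt (s := {w : ℂ | w.im < 0}) (fun w (hw : w.im < 0) => ?_) hU
    simpa only [Complex.conj_conj] using (hF.hasDerivAt (conj w)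
      (by simpa)).conj_conj.differentiableAt.differentiableWithinAt
  refine (InnerProductSpace.harmonicAt_congr_nhds ?_).2 han.harmonicAt_re
  filter_upwards [hU] with w hw
  exact reflectRe_of_nonpos (le_of_lt hw)

lemma harmonicAt_reflectRe_ofReal (hF : IsUpperPrimitive F f) {x : ℝ} (hf : AnalyticAt ℂ f x)
    (hreal : ∀ᶠ y : ℝ in 𝓝 x, (f y).im = 0) :
    InnerProductSpace.HarmonicAt (reflectRe F) (x : ℂ) := by
  obtain ⟨ε, hε, Φ, hΦ, hFΦ⟩ := hF.exists_local_extension hf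
  have hball := Metric.ball_mem_nhds (x : ℂ) hε
  have han : AnalyticAt ℂ Φ x := DifferentiableOn.analyticAt
    (fun w hw => (hΦ w hw).differentiableAt.differentiableWithinAt) hball
  refine (InnerProductSpace.harmonicAt_congr_nhds ?_).2 han.harmonicAt_re
  filter_upwards [hball] with w hw
  rcases le_total 0 w.im with him | him
  · rw [reflectRe_of_nonneg him, hFΦ w hw him]
  · rw [reflectRe_of_nonpos him, hFΦ _ (conj_mem_ball_ofReal hw) (by simpa)]
    exact re_conj_eq_re_of_hasDerivAt hΦ hreal hw

lemma harmonicAt_reflectRe (hF : IsUpperPrimitive F f)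
    (hz : z.im = 0 → AnalyticAt ℂ f z ∧ ∀ᶠ y : ℝ in 𝓝 z.re, (f y).im = 0) :
    InnerProductSpace.HarmonicAt (reflectRe F) z := by
  rcases lt_trichotomy z.im 0 with hneg | hzero | hpos
  · exact hF.harmonicAt_reflectRe_of_im_neg hneg
  · obtain ⟨hf, hreal⟩ := hz hzero
    obtain ⟨x, rfl⟩ : ∃ x : ℝ, (x : ℂ) = z := ⟨z.re, Complex.ext rfl hzero.symm⟩
    exact hF.harmonicAt_reflectRe_ofReal hf hreal
  · exact hF.harmonicAt_reflectRe_of_im_pos hpos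

end IsUpperPrimitive

end ReflectRe
/-! ### Behaviour at infinity -/

/-- The filter of neighbourhoods of infinity in the upper half-plane. -/
noncomputable def upperInfty : Filter ℂ := Bornology.cobounded ℂ ⊓ 𝓟 upperHalfPlaneSet

lemma eventually_upperInfty_im_pos : ∀ᶠ z in upperInfty, 0 < z.im :=
  mem_inf_of_right (mem_principal_self _)

lemma ne_zero_of_im_pos {z : ℂ} (hz : 0 < z.im) : z ≠ 0 := by
  rintro rfl
  exact hz.ne rfl

lemma neg_inv_im_pos {z : ℂ} (hz : 0 < z.im) : 0 < (-z⁻¹).im := by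
  rw [Complex.neg_im, Complex.inv_im, neg_div, neg_neg]
  exact div_pos hz (Complex.normSq_pos.2 (ne_zero_of_im_pos hz))

lemma tendsto_inv_upperInfty : Tendsto (fun z : ℂ => z⁻¹) upperInfty (𝓝 0) :=
  tendsto_inv₀_cobounded.mono_left inf_le_left

lemma tendsto_neg_inv_upperInfty :
    Tendsto (fun z : ℂ => -z⁻¹) upperInfty (𝓝[upperHalfPlaneSet] 0) :=
  tendsto_nhdsWithin_iff.2 ⟨by simpa only [neg_zero] using tendsto_inv_upperInfty.neg,
    eventually_upperInfty_im_pos.mono fun _ => neg_inv_im_pos⟩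

lemma tendsto_neg_inv_nhdsWithin_upperHalfPlane :
    Tendsto (fun w : ℂ => -w⁻¹) (𝓝[upperHalfPlaneSet] 0) upperInfty := by
  refine tendsto_inf.2 ⟨?_, tendsto_principal.2 <| eventually_mem_nhdsWithin.mono
    fun _ => neg_inv_im_pos⟩
  have hne : 𝓝[upperHalfPlaneSet] 0 ≤ 𝓝[≠] (0 : ℂ) :=
    nhdsWithin_mono _ fun _ => ne_zero_of_im_pos
  exact tendsto_neg_cobounded.comp (tendsto_inv₀_nhdsNE_zero.mono_left hne)

lemma isBigO_one_of_hasDerivAt_isBigO_one {D D' : ℂ → ℂ} {z : ℂ}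
    (hD : ∀ w : ℂ, 0 < w.im → HasDerivAt D (D' w) w)
    (hD' : D' =O[𝓝[upperHalfPlaneSet] z] fun _ => (1 : ℝ)) :
    D =O[𝓝[upperHalfPlaneSet] z] fun _ => (1 : ℝ) := by
  obtain ⟨C, hC⟩ := hD'.bound
  obtain ⟨ε, hε, hball⟩ := Metric.mem_nhdsWithin_iff.1 hC
  have hmem : Metric.ball z ε ∩ upperHalfPlaneSet ∈ 𝓝[upperHalfPlaneSet] z :=
    inter_mem (mem_nhdsWithin_of_mem_nhds (Metric.ball_mem_nhds z hε)) self_mem_nhdsWithin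
  rcases (Metric.ball z ε ∩ upperHalfPlaneSet).eq_empty_or_nonempty with hempty | ⟨w₀, hw₀⟩
  · rw [hempty, empty_mem_iff_bot] at hmem
    simp only [hmem, Asymptotics.isBigO_bot]
  have hlip : ∀ w ∈ Metric.ball z ε ∩ upperHalfPlaneSet, ‖D w - D w₀‖ ≤ C * ‖w - w₀‖ :=
    fun w hw => (convex_ball_inter_upperHalfPlane z ε).norm_image_sub_le_of_norm_hasDerivWithin_le
      (fun y hy => (hD y hy.2).hasDerivWithinAt)
      (fun y hy => by simpa only [norm_one, mul_one, mem_ofPred_eq] using hball hy) hw₀ hw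
  have hdiff : (fun w => D w - D w₀) =O[𝓝[upperHalfPlaneSet] z] fun w => w - w₀ :=
    Asymptotics.IsBigO.of_bound C (mem_of_superset hmem hlip)
  have hbdd : (fun w : ℂ => w - w₀) =O[𝓝[upperHalfPlaneSet] z] fun _ => (1 : ℝ) :=
    ((continuous_sub_right w₀).tendsto z |>.mono_left nhdsWithin_le_nhds).isBigO_one ℝ
  simpa only [sub_add_cancel] using (hdiff.trans hbdd).add
    (Asymptotics.isBigO_const_const (D w₀) one_ne_zero _)

/-- In the coordinate `w = -1 / z`, in which infinity becomes the boundary point `0` of the upper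
half-plane, the function has a bounded derivative. -/
lemma isBigO_one_of_hasDerivAt_isBigO_inv_sq {h h' : ℂ → ℂ}
    (hh : ∀ z : ℂ, 0 < z.im → HasDerivAt h (h' z) z)
    (hh' : h' =O[upperInfty] fun z => z⁻¹ ^ 2) : h =O[upperInfty] fun _ => (1 : ℝ) := by
  have hD : ∀ w : ℂ, 0 < w.im →
      HasDerivAt (fun w => h (-w⁻¹)) (h' (-w⁻¹) * (w ^ 2)⁻¹) w := fun w hw => by
    have hinv : HasDerivAt (fun w : ℂ => -w⁻¹) (w ^ 2)⁻¹ w := by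
      simpa only [neg_neg] using! (hasDerivAt_inv (ne_zero_of_im_pos hw)).neg
    exact (hh _ (neg_inv_im_pos hw)).comp w hinv
  have hD' : (fun w => h' (-w⁻¹) * (w ^ 2)⁻¹) =O[𝓝[upperHalfPlaneSet] 0] fun _ => (1 : ℝ) := by
    refine ((hh'.comp_tendsto tendsto_neg_inv_nhdsWithin_upperHalfPlane).mul
      (Asymptotics.isBigO_refl (fun w : ℂ => (w ^ 2)⁻¹) _)).trans
      (Asymptotics.IsBigO.of_bound 1 ?_)
    filter_upwards [self_mem_nhdsWithin] with w hw
    have hw0 : w ≠ 0 := ne_zero_of_im_pos hw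
    simp [hw0]
  simpa only [Function.comp_def, inv_neg, inv_inv, neg_neg] using
    (isBigO_one_of_hasDerivAt_isBigO_one hD hD').comp_tendsto tendsto_neg_inv_upperInfty

lemma exists_forall_of_eventually_upperInfty {P : ℂ → Prop} (h : ∀ᶠ z in upperInfty, P z) :
    ∃ R > 0, ∀ z : ℂ, 0 < z.im → R < ‖z‖ → P z := by
  rw [upperInfty, eventually_inf_principal] at h
  obtain ⟨R, -, hR⟩ := (hasBasis_cobounded_norm (E := ℂ)).eventually_iff.1 h
  refine ⟨max R 1, by positivity, fun z hz hzR => hR ?_ hz⟩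
  exact (le_max_left R 1).trans hzR.le

namespace IsUpperPrimitive

variable {F f : ℂ → ℂ}

lemma re_sub_log_isBigO (hF : IsUpperPrimitive F f)
    (hf : (fun z => f z - z⁻¹) =O[upperInfty] fun z => z⁻¹ ^ 2) :
    (fun z => (F z).re - Real.log ‖z‖) =O[upperInfty] fun _ => (1 : ℝ) := by
  have hlog : (fun z => F z - Complex.log z) =O[upperInfty] fun _ => (1 : ℝ) :=
    isBigO_one_of_hasDerivAt_isBigO_inv_sq
      (fun z hz => (hF.hasDerivAt z hz).sub (Complex.hasDerivAt_log (Or.inr hz.ne'))) hf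
  refine Asymptotics.IsBigO.trans (Asymptotics.isBigO_of_le _ fun z => ?_) hlog
  rw [← Complex.log_re, ← Complex.sub_re]
  exact Complex.abs_re_le_norm _

lemma reflectRe_sub_log_isBigO (hF : IsUpperPrimitive F f)
    (hf : (fun z => f z - z⁻¹) =O[upperInfty] fun z => z⁻¹ ^ 2) :
    (fun z => reflectRe F z - Real.log ‖z‖) =O[Bornology.cobounded ℂ] fun _ => (1 : ℝ) := by
  obtain ⟨C, hC⟩ := (hF.re_sub_log_isBigO hf).bound
  obtain ⟨R, hR, hbound⟩ := exists_forall_of_eventually_upperInfty hC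
  simp only [norm_one, mul_one] at hbound
  have hclosed : ∀ z : ℂ, 0 ≤ z.im → R < ‖z‖ → ‖reflectRe F z - Real.log ‖z‖‖ ≤ C := by
    intro z hz hzR
    have : (𝓝[upperHalfPlaneSet] z).NeBot := neBot_nhdsWithin_upperHalfPlane hz
    have hcont : ContinuousAt (fun z => ‖reflectRe F z - Real.log ‖z‖‖) z :=
      ((continuous_reflectRe hF.continuousOn).continuousAt.sub
        (continuous_norm.continuousAt.log (hR.trans hzR).ne')).norm
    refine le_of_tendsto (x := 𝓝[upperHalfPlaneSet] z)
      (hcont.tendsto.mono_left nhdsWithin_le_nhds) ?_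
    filter_upwards [self_mem_nhdsWithin, mem_nhdsWithin_of_mem_nhds
      ((isOpen_lt continuous_const continuous_norm).mem_nhds hzR)] with w (hw : 0 < w.im) hwR
    rw [reflectRe_of_nonneg hw.le]
    exact hbound w hw hwR
  refine Asymptotics.IsBigO.of_bound C ?_
  filter_upwards [tendsto_norm_cobounded_atTop.eventually_gt_atTop R] with z hz
  rw [norm_one, mul_one]
  rcases le_total 0 z.im with him | him
  · exact hclosed z him hz
  · rw [← reflectRe_conj, ← Complex.norm_conj z]
    exact hclosed (conj z) (by simpa) (by rwa [Complex.norm_conj])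

end IsUpperPrimitive

lemma upperSqrt_div_sub_one_isBigO (e : ℝ) :
    (fun z : ℂ => upperSqrt (z - e) / upperSqrt z - 1) =O[upperInfty] fun z => z⁻¹ := by
  refine Asymptotics.IsBigO.of_bound |e| ?_
  filter_upwards [eventually_upperInfty_im_pos] with z hz
  set ρ := upperSqrt (z - e) / upperSqrt z with hρ
  have hre : 0 ≤ ρ.re := by
    obtain ⟨hre, him⟩ := upperSqrt_mem_first_quadrant hz.le
    obtain ⟨hre', him'⟩ := upperSqrt_mem_first_quadrant (z := z - e) (by simpa using hz.le)
    have hnormSq := Complex.normSq_nonneg (upperSqrt z)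
    rw [hρ, Complex.div_re]
    positivity
  have hone : 1 ≤ ‖ρ + 1‖ := by
    refine le_trans ?_ (Complex.re_le_norm (ρ + 1))
    rw [Complex.add_re, Complex.one_re]
    linarith
  have hsq : (ρ - 1) * (ρ + 1) = -e * z⁻¹ := by
    have hz0 := ne_zero_of_im_pos hz
    calc (ρ - 1) * (ρ + 1) = ρ ^ 2 - 1 := by ring
      _ = (z - e) / z - 1 := by rw [hρ, div_pow, upperSqrt_sq, upperSqrt_sq]
      _ = -e * z⁻¹ := by
        field_simp
        ring
  calc ‖ρ - 1‖ ≤ ‖ρ - 1‖ * ‖ρ + 1‖ := le_mul_of_one_le_right (norm_nonneg _) hone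
    _ = |e| * ‖z⁻¹‖ := by rw [← norm_mul, hsq, norm_mul, norm_neg, Complex.norm_real,
      Real.norm_eq_abs]

lemma prod_upperSqrt_div_sub_one_isBigO (S : Finset ℝ) :
    (fun z : ℂ => ∏ e ∈ S, (upperSqrt (z - e) / upperSqrt z) - 1) =O[upperInfty]
      fun z => z⁻¹ := by
  induction S using Finset.induction_on with
  | empty => simpa only [Finset.prod_empty, sub_self] using Asymptotics.isBigO_zero _ _
  | insert e S he ih =>
    have hfactor := upperSqrt_div_sub_one_isBigO e
    have hprod : (fun z : ℂ => (∏ e ∈ S, (upperSqrt (z - e) / upperSqrt z) - 1) *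
        (upperSqrt (z - e) / upperSqrt z - 1)) =O[upperInfty] fun z => z⁻¹ := by
      simpa only [mul_one] using
        ih.mul (hfactor.trans (tendsto_inv_upperInfty.isBigO_one ℂ))
    refine ((hprod.add ih).add hfactor).congr_left fun z => ?_
    rw [Finset.prod_insert he]
    ring

lemma prod_upperSqrt_eq_pow_mul {S : Finset ℝ} {m : ℕ} (hcard : S.card = 2 * m) {z : ℂ}
    (hz : z ≠ 0) :
    ∏ e ∈ S, upperSqrt (z - e) = z ^ m * ∏ e ∈ S, (upperSqrt (z - e) / upperSqrt z) := by
  rw [Finset.prod_div_distrib, Finset.prod_const, hcard, pow_mul, upperSqrt_sq,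
    mul_div_cancel₀ _ (pow_ne_zero m hz)]

lemma branchQuot_sub_inv_isBigO {n : ℂ → ℂ} {S : Finset ℝ} {m : ℕ} (hcard : S.card = 2 * m)
    (hn : (fun z : ℂ => n z * z / z ^ m - 1) =O[upperInfty] fun z => z⁻¹) :
    (fun z => branchQuot n S z - z⁻¹) =O[upperInfty] fun z => z⁻¹ ^ 2 := by
  set P : ℂ → ℂ := fun z => ∏ e ∈ S, (upperSqrt (z - e) / upperSqrt z)
  have hP : (fun z => P z - 1) =O[upperInfty] fun z => z⁻¹ := prod_upperSqrt_div_sub_one_isBigO S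
  have hlim : Tendsto P upperInfty (𝓝 1) := by
    simpa only [sub_add_cancel, zero_add] using
      (hP.trans_tendsto tendsto_inv_upperInfty).add_const 1
  have hinv : (fun z => (P z)⁻¹) =O[upperInfty] fun _ => (1 : ℂ) :=
    (hlim.inv₀ one_ne_zero).isBigO_one ℂ
  have hmain := ((hn.sub hP).mul hinv).mul (Asymptotics.isBigO_refl (fun z : ℂ => z⁻¹) upperInfty)
  simp only [mul_one, ← sq] at hmain
  refine hmain.congr' ?_ EventuallyEq.rfl
  filter_upwards [eventually_upperInfty_im_pos,
    hlim.eventually (isOpen_ne.mem_nhds one_ne_zero)] with z hz (hPz : P z ≠ 0)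
  have hz0 := ne_zero_of_im_pos hz
  have hzm : z ^ m ≠ 0 := pow_ne_zero m hz0
  rw [branchQuot, prod_upperSqrt_eq_pow_mul hcard hz0]
  change (n z * z / z ^ m - 1 - (P z - 1)) * (P z)⁻¹ * z⁻¹ = n z / (z ^ m * P z) - z⁻¹
  field_simp
  ring

/-! ### Construction of Green functions -/

lemma sub_eq_sub_of_hasDerivAt_off_countable {u v w : ℝ → ℝ} {p q : ℝ} {S : Set ℝ}
    (hS : S.Countable) (hu : ContinuousOn u (Icc p q)) (hv : ContinuousOn v (Icc p q))
    (hu' : ∀ x ∈ Ioo p q \ S, HasDerivAt u (w x) x)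
    (hv' : ∀ x ∈ Ioo p q \ S, HasDerivAt v (w x) x) {x : ℝ} (hx : x ∈ Icc p q) :
    v x - u x = v p - u p := by
  have hint := MeasureTheory.integral_eq_of_hasDerivAt_off_countable_of_le (v - u) (fun _ => 0)
    hx.1 hS ((hv.sub hu).mono (Icc_subset_Icc_right hx.2)) (fun y hy => ?_)
    intervalIntegrable_const
  · rw [intervalIntegral.integral_zero] at hint
    exact sub_eq_zero.1 hint.symm
  · have hy' : y ∈ Ioo p q \ S := ⟨Ioo_subset_Ioo_right hx.2 hy.1, hy.2⟩
    simpa only [sub_self] using (hv' y hy').sub (hu' y hy')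

lemma exists_isGreenAtInfty {F f : ℂ → ℂ} (hF : IsUpperPrimitive F f)
    (hf : (fun z => f z - z⁻¹) =O[upperInfty] fun z => z⁻¹ ^ 2) {A S : Set ℝ} (hA : IsClosed A)
    (hS : S.Countable) (hSA : S ⊆ A) (hfS : ∀ x : ℝ, x ∉ S → AnalyticAt ℂ f x)
    (hreal : ∀ x : ℝ, x ∉ A → (f x).im = 0) {p q : ℝ} (hApq : A ⊆ Icc p q) {u : ℝ → ℝ}
    (hu : ContinuousOn u (Icc p q)) (hu' : ∀ x ∈ Ioo p q \ S, HasDerivAt u (f x).re x)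
    (hu0 : ∀ x ∈ A, u x = 0) :
    ∃ g, IsGreenAtInfty ((fun t : ℝ => (t : ℂ)) '' A) g ∧ ∀ x ∈ Icc p q, g x = u x := by
  have hcont : Continuous (reflectRe F) := continuous_reflectRe hF.continuousOn
  have hre : Continuous fun y : ℝ => (F y).re :=
    (hcont.comp Complex.continuous_ofReal).congr (reflectRe_ofReal F)
  set k := (F p).re - u p
  have hgu : ∀ x ∈ Icc p q, reflectRe F x - k = u x := fun x hx => by
    rw [reflectRe_ofReal, sub_eq_iff_eq_add, ← sub_eq_iff_eq_add']
    exact sub_eq_sub_of_hasDerivAt_off_countable hS hu hre.continuousOn hu'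
      (fun y hy => hF.hasDerivAt_re_ofReal (hfS y hy.2)) hx
  refine ⟨fun z => reflectRe F z - k, ⟨?_, hcont.sub continuous_const, ?_, ?_⟩, hgu⟩
  · refine InnerProductSpace.HarmonicOnNhd.sub (fun z hz => hF.harmonicAt_reflectRe fun him => ?_)
      (InnerProductSpace.harmonicOnNhd_const k)
    obtain ⟨x, rfl⟩ : ∃ x : ℝ, (x : ℂ) = z := ⟨z.re, Complex.ext rfl him.symm⟩
    have hxA : x ∉ A := fun h => hz ⟨x, h, rfl⟩
    exact ⟨hfS x fun h => hxA (hSA h), eventually_of_mem (hA.isOpen_compl.mem_nhds hxA) hreal⟩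
  · rintro _ ⟨x, hx, rfl⟩
    exact (hgu x (hApq hx)).trans (hu0 x hx)
  · refine ((hF.reflectRe_sub_log_isBigO hf).sub
      (Asymptotics.isBigO_const_const k one_ne_zero _)).congr_left fun z => ?_
    ring
/-! ### Integrals depending on a parameter -/

section ParametricIntegral

open Function (uncurry)

variable {k k' : ℝ → ℝ → ℝ} {J : Set ℝ}

lemma continuous_of_continuousOn_uncurry (hk : ContinuousOn (uncurry k) (J ×ˢ univ)) {α : ℝ}
    (hα : α ∈ J) : Continuous (k α) :=
  hk.comp_continuous (Continuous.prodMk_right α) fun _ => ⟨hα, mem_univ _⟩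

lemma continuous_integral_left {f : ℝ → ℝ} (hf : Continuous f) (c : ℝ) :
    Continuous fun t : ℝ => ∫ φ in t..c, f φ := by
  simp only [intervalIntegral.integral_symm c]
  exact (intervalIntegral.continuous_primitive (fun a b => hf.intervalIntegrable a b) c).neg

lemma hasDerivAt_integral_left {f : ℝ → ℝ} (hf : Continuous f) (t c : ℝ) :
    HasDerivAt (fun s : ℝ => ∫ φ in s..c, f φ) (-f t) t :=
  intervalIntegral.integral_hasDerivAt_left (hf.intervalIntegrable _ _)
    (hf.stronglyMeasurableAtFilter _ _) hf.continuousAt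

lemma continuousOn_integral_left_parametric (hk : ContinuousOn (uncurry k) (J ×ˢ univ)) (c : ℝ) :
    ContinuousOn (fun p : ℝ × ℝ => ∫ φ in p.2..c, k p.1 φ) (J ×ˢ univ) := by
  have hsub : Continuous (uncurry fun β : J => k β) :=
    hk.comp_continuous (f := fun p : J × ℝ => ((p.1 : ℝ), p.2)) (by fun_prop)
      fun p => ⟨p.1.2, mem_univ _⟩
  have hprim := intervalIntegral.continuous_parametric_primitive_of_continuous
    (μ := MeasureTheory.volume) (a₀ := c) hsub
  have hpair : Continuous fun p : ↥(J ×ˢ (univ : Set ℝ)) => ((⟨p.1.1, p.2.1⟩ : J), p.1.2) := by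
    fun_prop
  simp only [intervalIntegral.integral_symm c]
  rw [continuousOn_iff_continuous_domRestrict]
  exact (hprim.comp hpair).neg

lemma hasDerivAt_integral_parametric (hJ : IsOpen J)
    (hk : ContinuousOn (uncurry k) (J ×ˢ univ)) (hk' : ContinuousOn (uncurry k') (J ×ˢ univ))
    (hd : ∀ α ∈ J, ∀ φ, HasDerivAt (fun β => k β φ) (k' α φ) α) {α : ℝ} (hα : α ∈ J) (a b : ℝ) :
    HasDerivAt (fun β => ∫ φ in a..b, k β φ) (∫ φ in a..b, k' α φ) α := by
  obtain ⟨r, hr, hrJ⟩ := Metric.nhds_basis_closedBall.mem_iff.1 (hJ.mem_nhds hα)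
  obtain ⟨C, hC⟩ := ((isCompact_closedBall α r).prod (isCompact_uIcc (a := a) (b := b)))
    |>.exists_bound_of_continuousOn (hk'.mono (prod_mono hrJ (subset_univ _)))
  refine (intervalIntegral.hasDerivAt_integral_of_dominated_loc_of_deriv_le
    (F' := k') (bound := fun _ => C) (s := Metric.closedBall α r)
    (Metric.closedBall_mem_nhds α hr) ?_ ?_ ?_ ?_ intervalIntegrable_const ?_).2
  · filter_upwards [hJ.mem_nhds hα] with β hβ
    exact (continuous_of_continuousOn_uncurry hk hβ).aestronglyMeasurable
  · exact (continuous_of_continuousOn_uncurry hk hα).intervalIntegrable _ _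
  · exact (continuous_of_continuousOn_uncurry hk' hα).aestronglyMeasurable
  · exact Eventually.of_forall fun φ hφ β hβ => hC (β, φ) ⟨hβ, uIoc_subset_uIcc hφ⟩
  · exact Eventually.of_forall fun φ _ β hβ => hd β (hrJ hβ) φ

lemma hasDerivAt_integral_left_parametric (hJ : IsOpen J)
    (hk : ContinuousOn (uncurry k) (J ×ˢ univ)) (hk' : ContinuousOn (uncurry k') (J ×ˢ univ))
    (hd : ∀ α ∈ J, ∀ φ, HasDerivAt (fun β => k β φ) (k' α φ) α) {α : ℝ} (hα : α ∈ J)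
    {θ : ℝ → ℝ} {θ' : ℝ} (hθ : HasDerivAt θ θ' α) (c : ℝ) :
    HasDerivAt (fun β => ∫ φ in θ β..c, k β φ)
      ((∫ φ in θ α..c, k' α φ) - k α (θ α) * θ') α := by
  have hnhds : J ×ˢ univ ∈ 𝓝 (α, θ α) :=
    (hJ.prod isOpen_univ).mem_nhds ⟨hα, mem_univ _⟩
  have htotal := hasStrictFDerivAt_uncurry_coprod (𝕜 := ℝ) (u := (α, θ α))
    (f := fun β t => ∫ φ in t..c, k β φ)
    (f₁ := fun β t => ContinuousLinearMap.toSpanSingleton ℝ (∫ φ in t..c, k' β φ))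
    (f₂ := fun β t => ContinuousLinearMap.toSpanSingleton ℝ (-k β t))
    (by filter_upwards [hnhds] with p hp using
      (hasDerivAt_integral_parametric hJ hk hk' hd hp.1 p.2 c).hasFDerivAt)
    (by filter_upwards [hnhds] with p hp using
      (hasDerivAt_integral_left (continuous_of_continuousOn_uncurry hk hp.1) p.2 c).hasFDerivAt)
    ((ContinuousLinearMap.toSpanSingletonCLE (𝕜 := ℝ) (E := ℝ)).continuous.continuousAt.comp
      ((continuousOn_integral_left_parametric hk' c).continuousAt hnhds))
    ((ContinuousLinearMap.toSpanSingletonCLE (𝕜 := ℝ) (E := ℝ)).continuous.continuousAt.comp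
      (hk.neg.continuousAt hnhds))
  convert! htotal.hasFDerivAt.comp_hasDerivAt α ((hasDerivAt_id α).prodMk hθ) using 1
  simp only [Function.HasUncurry.uncurry, id_eq, ContinuousLinearMap.coprod_apply,
    ContinuousLinearMap.toSpanSingleton_apply, smul_eq_mul, one_mul, mul_neg]
  ring

lemma tendsto_integral_left_of_bounded {l : Filter ℝ} [l.IsCountablyGenerated] {k₀ : ℝ → ℝ}
    {θ : ℝ → ℝ} {θ₀ a c M : ℝ} (hk : ∀ᶠ β in l, Continuous (k β)) (hθ : Tendsto θ l (𝓝 θ₀))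
    (haθ : a < θ₀) (hθc : ∀ᶠ β in l, θ β ≤ c) (hc : θ₀ ≤ c)
    (hM : ∀ᶠ β in l, ∀ φ ∈ Icc a c, |k β φ| ≤ M)
    (hlim : ∀ φ ∈ Icc a c, Tendsto (fun β => k β φ) l (𝓝 (k₀ φ))) :
    Tendsto (fun β => ∫ φ in θ β..c, k β φ) l (𝓝 (∫ φ in θ₀..c, k₀ φ)) := by
  have hsub : uIoc θ₀ c ⊆ Icc a c := by
    rw [uIoc_of_le hc]
    exact fun φ hφ => ⟨(haθ.trans hφ.1).le, hφ.2⟩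
  have hfix : Tendsto (fun β => ∫ φ in θ₀..c, k β φ) l (𝓝 (∫ φ in θ₀..c, k₀ φ)) :=
    intervalIntegral.tendsto_integral_filter_of_dominated_convergence (fun _ => M)
      (hk.mono fun β hβ => hβ.aestronglyMeasurable)
      (hM.mono fun β hβ => Eventually.of_forall fun φ hφ => hβ φ (hsub hφ))
      intervalIntegrable_const (Eventually.of_forall fun φ hφ => hlim φ (hsub hφ))
  have hmove : Tendsto (fun β => ∫ φ in θ β..θ₀, k β φ) l (𝓝 0) := by
    have hzero : Tendsto (fun β => M * |θ₀ - θ β|) l (𝓝 0) := by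
      simpa using (hθ.const_sub θ₀).abs.const_mul M
    refine squeeze_zero_norm' ?_ hzero
    filter_upwards [hM, hθc, hθ.eventually (lt_mem_nhds haθ)] with β hβ hβc hβa
    exact intervalIntegral.norm_integral_le_of_norm_le_const fun φ hφ =>
      hβ φ (uIcc_subset_Icc ⟨hβa.le, hβc⟩ ⟨haθ.le, hc⟩ (uIoc_subset_uIcc hφ))
  have hsum := hmove.add hfix
  rw [zero_add] at hsum
  refine hsum.congr' ?_
  filter_upwards [hk] with β hβ
  exact intervalIntegral.integral_add_adjacent_intervals (hβ.intervalIntegrable _ _)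
    (hβ.intervalIntegrable _ _)

end ParametricIntegral

/-! ### The Green density in the gap -/

/-- The weight `1 / √(1 - t ^ 2)` at the point `t = α - δ cos φ` of the gap. -/
noncomputable def gapWeight (δ α φ : ℝ) : ℝ := (√(1 - (α - δ * Real.cos φ) ^ 2))⁻¹

/-- The derivative of `gapWeight` in `α`. -/
noncomputable def gapWeightDeriv (δ α φ : ℝ) : ℝ :=
  (α - δ * Real.cos φ) * gapWeight δ α φ ^ 3

/-- The density of the Green function in the angle `φ` parametrizing the gap by
`t = α - δ cos φ`, when the critical point of the Green function is `α + γ`. The first factor is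
`t - (α + γ)`, and the substitution absorbs the two square roots vanishing at the ends of the
gap. -/
noncomputable def gapDensity (δ γ α φ : ℝ) : ℝ := -(γ + δ * Real.cos φ) * gapWeight δ α φ

/-- The partial derivative of `gapDensity` in `α`. -/
noncomputable def gapDensityDeriv (δ γ α φ : ℝ) : ℝ :=
  -(γ + δ * Real.cos φ) * gapWeightDeriv δ α φ

/-- The displacement `γ` of the critical point of the Green function from the centre `α` of the
gap; it is the value for which `gapDensity δ γ α` has integral zero over the whole gap. -/
noncomputable def critOffset (δ α : ℝ) : ℝ :=
  (∫ φ in 0..Real.pi, gapDensity δ 0 α φ) / ∫ φ in 0..Real.pi, gapWeight δ α φ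

/-- The derivative of `critOffset` in `α`, obtained by implicit differentiation. -/
noncomputable def critOffsetDeriv (δ α : ℝ) : ℝ :=
  (∫ φ in 0..Real.pi, gapDensityDeriv δ (critOffset δ α) α φ) /
    ∫ φ in 0..Real.pi, gapWeight δ α φ

lemma one_sub_sq_pos {x : ℝ} (hx : x ∈ Ioo (-1 : ℝ) 1) : 0 < 1 - x ^ 2 := by
  nlinarith [hx.1, hx.2]

lemma hasDerivAt_inv_sqrt_one_sub_sq {x : ℝ} (hx : x ∈ Ioo (-1 : ℝ) 1) :
    HasDerivAt (fun y : ℝ => (√(1 - y ^ 2))⁻¹) (x * (√(1 - x ^ 2))⁻¹ ^ 3) x := by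
  have hpos := one_sub_sq_pos hx
  have hsqrt := (Real.sqrt_pos.2 hpos).ne'
  have hrad : HasDerivAt (fun y : ℝ => 1 - y ^ 2) (-(2 * x)) x := by
    simpa using ((hasDerivAt_id x).pow 2).const_sub 1
  convert! (hrad.sqrt hpos.ne').inv hsqrt using 1
  field_simp

lemma monotoneOn_div_one_sub_sq : MonotoneOn (fun x : ℝ => x / (1 - x ^ 2)) (Ioo (-1) 1) := by
  intro x hx y hy hxy
  change x / (1 - x ^ 2) ≤ y / (1 - y ^ 2)
  rw [div_le_div_iff₀ (one_sub_sq_pos hx) (one_sub_sq_pos hy)]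
  have : 0 < 1 + x * y := by nlinarith [hx.1, hx.2, hy.1, hy.2]
  nlinarith [mul_nonneg (sub_nonneg.2 hxy) this.le]

section Weight

open Function (uncurry)

variable {δ α : ℝ}

lemma gapPoint_mem_Ioo (hδ : 0 < δ) (hα : α ∈ Ioo (δ - 1) (1 - δ)) (φ : ℝ) :
    α - δ * Real.cos φ ∈ Ioo (-1 : ℝ) 1 := by
  have hle := Real.neg_one_le_cos φ
  have hge := Real.cos_le_one φ
  constructor <;> nlinarith [hα.1, hα.2]

lemma gapWeight_nonneg (δ α φ : ℝ) : 0 ≤ gapWeight δ α φ :=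
  inv_nonneg.2 (Real.sqrt_nonneg _)

lemma gapWeight_pos (hδ : 0 < δ) (hα : α ∈ Ioo (δ - 1) (1 - δ)) (φ : ℝ) :
    0 < gapWeight δ α φ :=
  inv_pos.2 (Real.sqrt_pos.2 (one_sub_sq_pos (gapPoint_mem_Ioo hδ hα φ)))

lemma gapWeight_le_inv_sqrt {c φ : ℝ} (hc : 0 < c) (h : c ≤ 1 - (α - δ * Real.cos φ) ^ 2) :
    gapWeight δ α φ ≤ (√c)⁻¹ :=
  inv_anti₀ (Real.sqrt_pos.2 hc) (Real.sqrt_le_sqrt h)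

lemma gapWeightDeriv_eq_div_mul (hδ : 0 < δ) (hα : α ∈ Ioo (δ - 1) (1 - δ)) (φ : ℝ) :
    gapWeightDeriv δ α φ =
      (α - δ * Real.cos φ) / (1 - (α - δ * Real.cos φ) ^ 2) * gapWeight δ α φ := by
  have hsq : gapWeight δ α φ ^ 2 = (1 - (α - δ * Real.cos φ) ^ 2)⁻¹ := by
    rw [gapWeight, inv_pow, Real.sq_sqrt (one_sub_sq_pos (gapPoint_mem_Ioo hδ hα φ)).le]
  rw [gapWeightDeriv, pow_succ, hsq]
  ring

lemma continuousOn_gapWeight (hδ : 0 < δ) :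
    ContinuousOn (uncurry (gapWeight δ)) (Ioo (δ - 1) (1 - δ) ×ˢ univ) := by
  unfold uncurry gapWeight
  refine ContinuousOn.inv₀ (by fun_prop) fun p hp => ?_
  exact (Real.sqrt_pos.2 (one_sub_sq_pos (gapPoint_mem_Ioo hδ hp.1 p.2))).ne'

lemma continuousOn_gapWeightDeriv (hδ : 0 < δ) :
    ContinuousOn (uncurry (gapWeightDeriv δ)) (Ioo (δ - 1) (1 - δ) ×ˢ univ) := by
  have hpoint : ContinuousOn (fun p : ℝ × ℝ => p.1 - δ * Real.cos p.2)
      (Ioo (δ - 1) (1 - δ) ×ˢ univ) := by fun_prop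
  exact hpoint.mul ((continuousOn_gapWeight hδ).pow 3)

lemma continuousOn_gapDensity (hδ : 0 < δ) (γ : ℝ) :
    ContinuousOn (uncurry (gapDensity δ γ)) (Ioo (δ - 1) (1 - δ) ×ˢ univ) := by
  have hfactor : ContinuousOn (fun p : ℝ × ℝ => -(γ + δ * Real.cos p.2))
      (Ioo (δ - 1) (1 - δ) ×ˢ univ) := by fun_prop
  exact hfactor.mul (continuousOn_gapWeight hδ)

lemma continuousOn_gapDensityDeriv (hδ : 0 < δ) (γ : ℝ) :
    ContinuousOn (uncurry (gapDensityDeriv δ γ)) (Ioo (δ - 1) (1 - δ) ×ˢ univ) := by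
  have hfactor : ContinuousOn (fun p : ℝ × ℝ => -(γ + δ * Real.cos p.2))
      (Ioo (δ - 1) (1 - δ) ×ˢ univ) := by fun_prop
  exact hfactor.mul (continuousOn_gapWeightDeriv hδ)

lemma continuous_gapWeight (hδ : 0 < δ) (hα : α ∈ Ioo (δ - 1) (1 - δ)) :
    Continuous (gapWeight δ α) :=
  continuous_of_continuousOn_uncurry (continuousOn_gapWeight hδ) hα

lemma continuous_gapDensity (hδ : 0 < δ) (hα : α ∈ Ioo (δ - 1) (1 - δ)) (γ : ℝ) :
    Continuous (gapDensity δ γ α) :=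
  continuous_of_continuousOn_uncurry (continuousOn_gapDensity hδ γ) hα

lemma continuous_gapDensityDeriv (hδ : 0 < δ) (hα : α ∈ Ioo (δ - 1) (1 - δ)) (γ : ℝ) :
    Continuous (gapDensityDeriv δ γ α) :=
  continuous_of_continuousOn_uncurry (continuousOn_gapDensityDeriv hδ γ) hα

lemma hasDerivAt_gapWeight (hδ : 0 < δ) (hα : α ∈ Ioo (δ - 1) (1 - δ)) (φ : ℝ) :
    HasDerivAt (fun β => gapWeight δ β φ) (gapWeightDeriv δ α φ) α :=
  (hasDerivAt_inv_sqrt_one_sub_sq (gapPoint_mem_Ioo hδ hα φ)).comp_sub_const α (δ * Real.cos φ)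

lemma hasDerivAt_gapWeight_angle (hδ : 0 < δ) (hα : α ∈ Ioo (δ - 1) (1 - δ)) (φ : ℝ) :
    HasDerivAt (gapWeight δ α) (gapWeightDeriv δ α φ * (δ * Real.sin φ)) φ := by
  have hpoint : HasDerivAt (fun ψ => α - δ * Real.cos ψ) (δ * Real.sin φ) φ := by
    simpa using ((Real.hasDerivAt_cos φ).const_mul δ).const_sub α
  exact HasDerivAt.comp (h₂ := fun y : ℝ => (√(1 - y ^ 2))⁻¹) φ
    (hasDerivAt_inv_sqrt_one_sub_sq (gapPoint_mem_Ioo hδ hα φ)) hpoint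

lemma hasDerivAt_gapDensity (hδ : 0 < δ) (hα : α ∈ Ioo (δ - 1) (1 - δ)) (γ φ : ℝ) :
    HasDerivAt (fun β => gapDensity δ γ β φ) (gapDensityDeriv δ γ α φ) α :=
  (hasDerivAt_gapWeight hδ hα φ).const_mul _

lemma integral_gapWeight_pos (hδ : 0 < δ) (hα : α ∈ Ioo (δ - 1) (1 - δ)) :
    0 < ∫ φ in 0..Real.pi, gapWeight δ α φ :=
  intervalIntegral.intervalIntegral_pos_of_pos
    ((continuous_gapWeight hδ hα).intervalIntegrable _ _) (gapWeight_pos hδ hα) Real.pi_pos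

lemma integral_gapDensity_sub (hδ : 0 < δ) (hα : α ∈ Ioo (δ - 1) (1 - δ)) (γ γ' a b : ℝ) :
    (∫ φ in a..b, gapDensity δ γ α φ) - (∫ φ in a..b, gapDensity δ γ' α φ) =
      (γ' - γ) * ∫ φ in a..b, gapWeight δ α φ := by
  rw [← intervalIntegral.integral_sub
    ((continuous_gapDensity hδ hα γ).intervalIntegrable _ _)
    ((continuous_gapDensity hδ hα γ').intervalIntegrable _ _),
    ← intervalIntegral.integral_const_mul]
  refine intervalIntegral.integral_congr fun φ _ => ?_
  simp only [gapDensity]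
  ring

end Weight

/-! ### The critical point of the Green function -/

section CriticalPoint

variable {δ α : ℝ}

lemma critOffset_sub (hδ : 0 < δ) (hα : α ∈ Ioo (δ - 1) (1 - δ)) (γ : ℝ) :
    critOffset δ α - γ =
      (∫ φ in 0..Real.pi, gapDensity δ γ α φ) / ∫ φ in 0..Real.pi, gapWeight δ α φ := by
  have hsub := integral_gapDensity_sub hδ hα 0 γ 0 Real.pi
  rw [critOffset, eq_div_iff (integral_gapWeight_pos hδ hα).ne', sub_mul,
    div_mul_cancel₀ _ (integral_gapWeight_pos hδ hα).ne']
  linarith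

lemma integral_gapDensity_critOffset (hδ : 0 < δ) (hα : α ∈ Ioo (δ - 1) (1 - δ)) :
    ∫ φ in 0..Real.pi, gapDensity δ (critOffset δ α) α φ = 0 := by
  have h := critOffset_sub hδ hα (critOffset δ α)
  rw [sub_self, eq_comm, div_eq_zero_iff] at h
  exact h.resolve_right (integral_gapWeight_pos hδ hα).ne'

lemma neg_one_lt_cos_of_mem_Ioo {φ : ℝ} (hφ : φ ∈ Ioo 0 Real.pi) : -1 < Real.cos φ := by
  rw [← Real.cos_pi]
  exact Real.cos_lt_cos_of_nonneg_of_le_pi hφ.1.le le_rfl hφ.2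

lemma cos_lt_one_of_mem_Ioo {φ : ℝ} (hφ : φ ∈ Ioo 0 Real.pi) : Real.cos φ < 1 := by
  rw [← Real.cos_zero]
  exact Real.cos_lt_cos_of_nonneg_of_le_pi le_rfl hφ.2.le hφ.1

lemma neg_lt_critOffset (hδ : 0 < δ) (hα : α ∈ Ioo (δ - 1) (1 - δ)) : -δ < critOffset δ α := by
  rw [← sub_pos, critOffset_sub hδ hα]
  refine div_pos (intervalIntegral.intervalIntegral_pos_of_pos_on
    ((continuous_gapDensity hδ hα _).intervalIntegrable _ _) (fun φ hφ => ?_) Real.pi_pos)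
    (integral_gapWeight_pos hδ hα)
  exact mul_pos (by nlinarith [cos_lt_one_of_mem_Ioo hφ]) (gapWeight_pos hδ hα φ)

lemma critOffset_lt (hδ : 0 < δ) (hα : α ∈ Ioo (δ - 1) (1 - δ)) : critOffset δ α < δ := by
  rw [← sub_neg, critOffset_sub hδ hα]
  refine div_neg_of_neg_of_pos ?_ (integral_gapWeight_pos hδ hα)
  rw [← Left.neg_pos_iff, ← intervalIntegral.integral_neg]
  refine intervalIntegral.intervalIntegral_pos_of_pos_on
    ((continuous_gapDensity hδ hα _).neg.intervalIntegrable _ _) (fun φ hφ => ?_) Real.pi_pos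
  rw [gapDensity, neg_mul, neg_neg]
  exact mul_pos (by nlinarith [neg_one_lt_cos_of_mem_Ioo hφ]) (gapWeight_pos hδ hα φ)

lemma add_critOffset_mem_Ioo (hδ : 0 < δ) (hα : α ∈ Ioo (δ - 1) (1 - δ)) :
    α + critOffset δ α ∈ Ioo (-1 : ℝ) 1 :=
  ⟨by linarith [hα.1, neg_lt_critOffset hδ hα], by linarith [hα.2, critOffset_lt hδ hα]⟩

lemma hasDerivAt_critOffset (hδ : 0 < δ) (hα : α ∈ Ioo (δ - 1) (1 - δ)) :
    HasDerivAt (critOffset δ) (critOffsetDeriv δ α) α := by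
  set γ := critOffset δ α with hγ
  have hdensity := hasDerivAt_integral_parametric isOpen_Ioo (continuousOn_gapDensity hδ γ)
    (continuousOn_gapDensityDeriv hδ γ) (fun β hβ φ => hasDerivAt_gapDensity hδ hβ γ φ) hα 0
    Real.pi
  have hweight := hasDerivAt_integral_parametric isOpen_Ioo (continuousOn_gapWeight hδ)
    (continuousOn_gapWeightDeriv hδ) (fun β hβ φ => hasDerivAt_gapWeight hδ hβ φ) hα 0 Real.pi
  have hpos := integral_gapWeight_pos hδ hα
  have hquot := ((hdensity.div hweight hpos.ne').const_add γ).congr_of_eventuallyEq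
    (f₁ := critOffset δ) <| by
      filter_upwards [isOpen_Ioo.mem_nhds hα] with β hβ
      rw [Pi.div_apply, ← critOffset_sub hδ hβ γ, add_sub_cancel]
  convert! hquot using 1
  rw [integral_gapDensity_critOffset hδ hα, critOffsetDeriv, ← hγ]
  field_simp
  ring

lemma mul_gapDensity_le_gapDensityDeriv (hδ : 0 < δ) (hα : α ∈ Ioo (δ - 1) (1 - δ)) {γ : ℝ}
    (hγ : α + γ ∈ Ioo (-1 : ℝ) 1) (φ : ℝ) :
    (α + γ) / (1 - (α + γ) ^ 2) * gapDensity δ γ α φ ≤ gapDensityDeriv δ γ α φ := by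
  have hx := gapPoint_mem_Ioo hδ hα φ
  set x := α - δ * Real.cos φ with hx_def
  set L := (α + γ) / (1 - (α + γ) ^ 2)
  have hfactor : gapDensityDeriv δ γ α φ - L * gapDensity δ γ α φ =
      gapWeight δ α φ * ((x - (α + γ)) * (x / (1 - x ^ 2) - L)) := by
    rw [gapDensityDeriv, gapDensity, gapWeightDeriv_eq_div_mul hδ hα, ← hx_def]
    linear_combination (-(gapWeight δ α φ) * (x / (1 - x ^ 2) - L)) * hx_def
  rw [← sub_nonneg, hfactor]
  refine mul_nonneg (gapWeight_nonneg δ α φ) ?_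
  rcases le_total (α + γ) x with h | h
  · exact mul_nonneg (sub_nonneg.2 h) (sub_nonneg.2 (monotoneOn_div_one_sub_sq hγ hx h))
  · exact mul_nonneg_of_nonpos_of_nonpos (sub_nonpos.2 h)
      (sub_nonpos.2 (monotoneOn_div_one_sub_sq hx hγ h))

lemma critOffsetDeriv_nonneg (hδ : 0 < δ) (hα : α ∈ Ioo (δ - 1) (1 - δ)) :
    0 ≤ critOffsetDeriv δ α := by
  refine div_nonneg ?_ (integral_gapWeight_pos hδ hα).le
  have hmono := intervalIntegral.integral_mono_on (μ := MeasureTheory.volume) Real.pi_pos.le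
    (((continuous_gapDensity hδ hα _).const_mul _).intervalIntegrable _ _)
    ((continuous_gapDensityDeriv hδ hα _).intervalIntegrable _ _)
    fun φ _ => mul_gapDensity_le_gapDensityDeriv hδ hα (add_critOffset_mem_Ioo hδ hα) φ
  rwa [intervalIntegral.integral_const_mul, integral_gapDensity_critOffset hδ hα, mul_zero]
    at hmono

end CriticalPoint

/-! ### The Green function on the gap as an integral -/

/-- The angle `θ` with `x = α - δ cos θ` for `x` in the gap `(α - δ, α + δ)`. To the left of the gap
it is `0`, and to the right of the gap it is `π`. -/
noncomputable def gapAngle (δ α x : ℝ) : ℝ := Real.arccos ((α - x) / δ)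

/-- The integral representing the Green function at a point `x` of the gap `(α - δ, α + δ)`, when
the critical point of the Green function is `α + γ`. -/
noncomputable def gapGreen (δ γ α x : ℝ) : ℝ :=
  ∫ φ in gapAngle δ α x..Real.pi, gapDensity δ γ α φ

section GapGreen

variable {δ γ α x : ℝ}

@[fun_prop]
lemma continuous_gapAngle (δ α : ℝ) : Continuous (gapAngle δ α) := by
  unfold gapAngle
  fun_prop

lemma gapAngle_le_pi (δ α x : ℝ) : gapAngle δ α x ≤ Real.pi := Real.arccos_le_pi _

lemma gapAngle_of_le (hδ : 0 < δ) (hx : x ≤ α - δ) : gapAngle δ α x = 0 := by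
  rw [gapAngle, Real.arccos_eq_zero, le_div_iff₀ hδ]
  linarith

lemma gapAngle_of_ge (hδ : 0 < δ) (hx : α + δ ≤ x) : gapAngle δ α x = Real.pi := by
  rw [gapAngle, Real.arccos_eq_pi, div_le_iff₀ hδ]
  linarith

lemma gapAngle_sub_mul_cos (hδ : 0 < δ) (α : ℝ) {θ : ℝ} (hθ : θ ∈ Icc 0 Real.pi) :
    gapAngle δ α (α - δ * Real.cos θ) = θ := by
  rw [gapAngle, sub_sub_cancel, mul_div_cancel_left₀ _ hδ.ne', Real.arccos_cos hθ.1 hθ.2]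

lemma div_mem_Ioo_of_mem_gap (hδ : 0 < δ) (hx : x ∈ Ioo (α - δ) (α + δ)) :
    (α - x) / δ ∈ Ioo (-1 : ℝ) 1 := by
  rw [mem_Ioo, lt_div_iff₀ hδ, div_lt_iff₀ hδ]
  constructor <;> linarith [hx.1, hx.2]

lemma gapAngle_mem_Ioo (hδ : 0 < δ) (hx : x ∈ Ioo (α - δ) (α + δ)) :
    gapAngle δ α x ∈ Ioo 0 Real.pi := by
  have hdiv := div_mem_Ioo_of_mem_gap hδ hx
  refine ⟨Real.arccos_pos.2 hdiv.2, (gapAngle_le_pi δ α x).lt_of_ne fun h => ?_⟩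
  exact hdiv.1.not_ge (Real.arccos_eq_pi.1 h)

lemma mul_cos_gapAngle (hδ : 0 < δ) (hx : x ∈ Ioo (α - δ) (α + δ)) :
    δ * Real.cos (gapAngle δ α x) = α - x := by
  have hdiv := div_mem_Ioo_of_mem_gap hδ hx
  rw [gapAngle, Real.cos_arccos hdiv.1.le hdiv.2.le, mul_div_cancel₀ _ hδ.ne']

lemma mul_sin_gapAngle (hδ : 0 < δ) (hx : x ∈ Ioo (α - δ) (α + δ)) :
    δ * Real.sin (gapAngle δ α x) = √(x - (α - δ)) * √(α + δ - x) := by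
  rw [gapAngle, Real.sin_arccos, ← Real.sqrt_mul (by linarith [hx.1])]
  nth_rewrite 1 [← Real.sqrt_sq hδ.le]
  rw [← Real.sqrt_mul (by positivity)]
  congr 1
  field_simp
  ring

lemma hasDerivAt_arccos_div (hδ : 0 < δ) {u : ℝ → ℝ} {u' t : ℝ} (hu : HasDerivAt u u' t)
    (hut : u t / δ ∈ Ioo (-1 : ℝ) 1) :
    HasDerivAt (fun s => Real.arccos (u s / δ))
      (-u' / (δ * Real.sin (Real.arccos (u t / δ)))) t := by
  convert! HasDerivAt.comp (h₂ := Real.arccos) t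
    (Real.hasDerivAt_arccos hut.1.ne' hut.2.ne) (hu.div_const δ) using 1
  rw [Real.sin_arccos]
  have := (Real.sqrt_pos.2 (one_sub_sq_pos hut)).ne'
  field_simp

lemma hasDerivAt_gapAngle (hδ : 0 < δ) (hx : x ∈ Ioo (α - δ) (α + δ)) :
    HasDerivAt (gapAngle δ α) (1 / (δ * Real.sin (gapAngle δ α x))) x := by
  simpa using! hasDerivAt_arccos_div hδ ((hasDerivAt_id x).const_sub α)
    (div_mem_Ioo_of_mem_gap hδ hx)

lemma hasDerivAt_gapAngle_center (hδ : 0 < δ) (hx : x ∈ Ioo (α - δ) (α + δ)) :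
    HasDerivAt (fun β => gapAngle δ β x) (-1 / (δ * Real.sin (gapAngle δ α x))) α :=
  hasDerivAt_arccos_div hδ ((hasDerivAt_id α).sub_const x) (div_mem_Ioo_of_mem_gap hδ hx)

lemma gapGreen_of_le (hδ : 0 < δ) (hα : α ∈ Ioo (δ - 1) (1 - δ)) (hx : x ≤ α - δ) :
    gapGreen δ (critOffset δ α) α x = 0 := by
  rw [gapGreen, gapAngle_of_le hδ hx, integral_gapDensity_critOffset hδ hα]

lemma gapGreen_of_ge (hδ : 0 < δ) (hx : α + δ ≤ x) : gapGreen δ γ α x = 0 := by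
  rw [gapGreen, gapAngle_of_ge hδ hx, intervalIntegral.integral_same]

lemma hasDerivAt_gapGreen_of_lt (hδ : 0 < δ) (hα : α ∈ Ioo (δ - 1) (1 - δ)) (hx : x < α - δ) :
    HasDerivAt (gapGreen δ (critOffset δ α) α) 0 x := by
  refine (hasDerivAt_const x (0 : ℝ)).congr_of_eventuallyEq ?_
  filter_upwards [Iio_mem_nhds hx] with y hy using gapGreen_of_le hδ hα (le_of_lt hy)

lemma hasDerivAt_gapGreen_of_gt (hδ : 0 < δ) (hx : α + δ < x) :
    HasDerivAt (gapGreen δ γ α) 0 x := by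
  refine (hasDerivAt_const x (0 : ℝ)).congr_of_eventuallyEq ?_
  filter_upwards [Ioi_mem_nhds hx] with y hy using gapGreen_of_ge hδ (le_of_lt hy)

lemma continuous_gapGreen (hf : Continuous (gapDensity δ γ α)) : Continuous (gapGreen δ γ α) :=
  (continuous_integral_left hf Real.pi).comp (continuous_gapAngle δ α)

lemma hasDerivAt_gapGreen (hδ : 0 < δ) (hf : Continuous (gapDensity δ γ α))
    (hx : x ∈ Ioo (α - δ) (α + δ)) (hx1 : -1 < x) :
    HasDerivAt (gapGreen δ γ α)
      ((α + γ - x) / (√(x + 1) * √(1 - x) * √(x - (α - δ)) * √(α + δ - x))) x := by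
  have hweight : gapWeight δ α (gapAngle δ α x) = (√(x + 1) * √(1 - x))⁻¹ := by
    rw [gapWeight, mul_cos_gapAngle hδ hx, ← Real.sqrt_mul (by linarith)]
    congr 2
    ring
  convert! (hasDerivAt_integral_left hf _ Real.pi).comp x (hasDerivAt_gapAngle hδ hx) using 1
  rw [gapDensity, mul_cos_gapAngle hδ hx, hweight, mul_sin_gapAngle hδ hx]
  ring

end GapGreen

/-! ### Identification of the Green functions -/

section BoundaryValues

variable {n : ℂ → ℂ} {S : Finset ℝ} {x r : ℝ}

lemma upperSqrt_ofReal_sub (x e : ℝ) :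
    upperSqrt ((x : ℂ) - e) = (if x < e then Complex.I else 1) * (√|x - e| : ℝ) := by
  rw [← Complex.ofReal_sub]
  split_ifs with h
  · rw [upperSqrt_ofReal_of_nonpos (sub_nonpos.2 h.le), abs_of_neg (sub_neg.2 h)]
  · rw [upperSqrt_ofReal_of_nonneg (sub_nonneg.2 (not_lt.1 h)),
      abs_of_nonneg (sub_nonneg.2 (not_lt.1 h)), one_mul]

lemma branchQuot_ofReal (n : ℂ → ℂ) (S : Finset ℝ) (x : ℝ) :
    branchQuot n S x =
      n x / (Complex.I ^ (S.filter (x < ·)).card * ((∏ e ∈ S, √|x - e| : ℝ) : ℂ)) := by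
  simp only [branchQuot, upperSqrt_ofReal_sub, Finset.prod_mul_distrib, Complex.ofReal_prod,
    ← Finset.prod_filter, Finset.prod_const]

lemma branchQuot_ofReal_of_even (hn : n x = r) {j : ℕ} (hj : (S.filter (x < ·)).card = 2 * j) :
    branchQuot n S x = (r / ((-1) ^ j * ∏ e ∈ S, √|x - e|) : ℝ) := by
  rw [branchQuot_ofReal, hn, hj, pow_mul, Complex.I_sq]
  push_cast
  rfl

lemma re_branchQuot_ofReal_of_odd (hn : n x = r) (hodd : Odd (S.filter (x < ·)).card) :
    (branchQuot n S x).re = 0 := by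
  obtain ⟨j, hj⟩ := hodd
  have himag : branchQuot n S x =
      ((-r / ((-1) ^ j * ∏ e ∈ S, √|x - e|) : ℝ) : ℂ) * Complex.I := by
    rw [branchQuot_ofReal, hn, hj, pow_succ, pow_mul, Complex.I_sq, mul_right_comm,
      div_mul_eq_div_div, Complex.div_I]
    push_cast
    ring
  rw [himag, Complex.re_ofReal_mul, Complex.I_re, mul_zero]

end BoundaryValues

/-- The end points of the two intervals of `twoIntervals α δ`. -/
noncomputable def bandEdges (δ α : ℝ) : Finset ℝ := {-1, α - δ, α + δ, 1}

section Identification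

variable {δ α x : ℝ}

@[to_additive]
lemma prod_bandEdges {M : Type*} [CommMonoid M] (hδ : 0 < δ) (hα : α ∈ Ioo (δ - 1) (1 - δ))
    (f : ℝ → M) :
    ∏ e ∈ bandEdges δ α, f e = f (-1) * (f (α - δ) * (f (α + δ) * f 1)) := by
  obtain ⟨hleft, hright⟩ := hα
  rw [bandEdges, Finset.prod_insert, Finset.prod_insert, Finset.prod_pair]
  · linarith
  · simp only [Finset.mem_insert, Finset.mem_singleton, not_or]
    constructor <;> linarith
  · simp only [Finset.mem_insert, Finset.mem_singleton, not_or]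
    refine ⟨?_, ?_, ?_⟩ <;> linarith

lemma card_bandEdges (hδ : 0 < δ) (hα : α ∈ Ioo (δ - 1) (1 - δ)) : (bandEdges δ α).card = 4 := by
  rw [Finset.card_eq_sum_ones, sum_bandEdges hδ hα]
  norm_num

lemma card_filter_lt_bandEdges (hδ : 0 < δ) (hα : α ∈ Ioo (δ - 1) (1 - δ)) (x : ℝ) :
    ((bandEdges δ α).filter (x < ·)).card =
      (if x < -1 then 1 else 0) + ((if x < α - δ then 1 else 0) +
        ((if x < α + δ then 1 else 0) + if x < 1 then 1 else 0)) := by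
  rw [Finset.card_filter, sum_bandEdges hδ hα]

lemma card_filter_lt_bandEdges_of_mem_gap (hδ : 0 < δ) (hα : α ∈ Ioo (δ - 1) (1 - δ))
    (hx : x ∈ Ioo (α - δ) (α + δ)) : ((bandEdges δ α).filter (x < ·)).card = 2 := by
  rw [card_filter_lt_bandEdges hδ hα, if_neg (by linarith [hx.1, hα.1]), if_neg hx.1.not_gt,
    if_pos hx.2, if_pos (by linarith [hx.2, hα.2])]

lemma even_card_filter_lt_bandEdges (hδ : 0 < δ) (hα : α ∈ Ioo (δ - 1) (1 - δ))
    (hx : x ∉ Icc (-1) 1 \ Ioo (α - δ) (α + δ)) :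
    Even ((bandEdges δ α).filter (x < ·)).card := by
  by_cases hgap : x ∈ Ioo (α - δ) (α + δ)
  · exact card_filter_lt_bandEdges_of_mem_gap hδ hα hgap ▸ even_two
  obtain ⟨hleft, hright⟩ := hα
  rw [card_filter_lt_bandEdges hδ ⟨hleft, hright⟩]
  rcases lt_or_ge x (-1) with hx1 | hx1
  · rw [if_pos hx1, if_pos (by linarith), if_pos (by linarith), if_pos (by linarith)]
    decide
  · have hx2 : 1 < x := by
      by_contra! hx2
      exact hx ⟨⟨hx1, hx2⟩, hgap⟩
    rw [if_neg (by linarith), if_neg (by linarith), if_neg (by linarith), if_neg (by linarith)]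
    exact Even.zero

lemma odd_card_filter_lt_bandEdges (hδ : 0 < δ) (hα : α ∈ Ioo (δ - 1) (1 - δ))
    (hx : x ∈ Ico (-1) (α - δ) ∪ Ico (α + δ) 1) :
    Odd ((bandEdges δ α).filter (x < ·)).card := by
  obtain ⟨hleft, hright⟩ := hα
  rw [card_filter_lt_bandEdges hδ ⟨hleft, hright⟩]
  rcases hx with ⟨hx1, hx2⟩ | ⟨hx1, hx2⟩
  · rw [if_neg (by linarith), if_pos (by linarith), if_pos (by linarith), if_pos (by linarith)]
    decide
  · rw [if_neg (by linarith), if_neg (by linarith), if_neg (by linarith), if_pos (by linarith)]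
    decide

lemma bandEdges_subset (hδ : 0 < δ) (hα : α ∈ Ioo (δ - 1) (1 - δ)) :
    (bandEdges δ α : Set ℝ) ⊆ Icc (-1) 1 \ Ioo (α - δ) (α + δ) := by
  obtain ⟨hleft, hright⟩ := hα
  intro e he
  simp only [bandEdges, Finset.coe_insert, Finset.coe_singleton, mem_insert_iff,
    mem_singleton_iff] at he
  simp only [Set.mem_sdiff, mem_Icc, mem_Ioo, not_and, not_lt]
  rcases he with rfl | rfl | rfl | rfl <;> refine ⟨⟨?_, ?_⟩, fun _ => ?_⟩ <;> linarith

lemma hasDerivAt_gapGreen_re_branchQuot (hδ : 0 < δ) (hα : α ∈ Ioo (δ - 1) (1 - δ))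
    (hx : x ∈ Ioo (-1) 1 \ (bandEdges δ α : Set ℝ)) :
    HasDerivAt (gapGreen δ (critOffset δ α) α)
      (branchQuot (fun z => z - (α + critOffset δ α : ℝ)) (bandEdges δ α) x).re x := by
  obtain ⟨⟨hx1, hx2⟩, hedge⟩ := hx
  simp only [bandEdges, Finset.coe_insert, Finset.coe_singleton, mem_insert_iff,
    mem_singleton_iff, not_or] at hedge
  set n : ℂ → ℂ := fun z => z - (α + critOffset δ α : ℝ)
  have hnum : n x = (x - (α + critOffset δ α) : ℝ) := (Complex.ofReal_sub _ _).symm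
  rcases lt_or_gt_of_ne hedge.2.1 with hleft | hleft
  · rw [re_branchQuot_ofReal_of_odd hnum
      (odd_card_filter_lt_bandEdges hδ hα (Or.inl ⟨hx1.le, hleft⟩))]
    exact hasDerivAt_gapGreen_of_lt hδ hα hleft
  rcases lt_or_gt_of_ne hedge.2.2.1 with hright | hright
  · convert! hasDerivAt_gapGreen hδ (continuous_gapDensity hδ hα _) ⟨hleft, hright⟩ hx1 using 1
    rw [branchQuot_ofReal_of_even (j := 1) hnum
      (card_filter_lt_bandEdges_of_mem_gap hδ hα ⟨hleft, hright⟩), Complex.ofReal_re,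
      prod_bandEdges hδ hα, sub_neg_eq_add, abs_of_pos (by linarith), abs_of_pos (sub_pos.2 hleft),
      abs_sub_comm x, abs_of_pos (sub_pos.2 hright), abs_sub_comm x, abs_of_pos (sub_pos.2 hx2)]
    ring
  · rw [re_branchQuot_ofReal_of_odd hnum
      (odd_card_filter_lt_bandEdges hδ hα (Or.inr ⟨hright.le, hx2⟩))]
    exact hasDerivAt_gapGreen_of_gt hδ hright

lemma exists_isGreenAtInfty_twoIntervals (hδ : 0 < δ) (hα : α ∈ Ioo (δ - 1) (1 - δ)) :
    ∃ g, IsGreenAtInfty (twoIntervals α δ) g ∧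
      ∀ x ∈ Icc (-1 : ℝ) 1, g x = gapGreen δ (critOffset δ α) α x := by
  set c : ℝ := α + critOffset δ α
  set n : ℂ → ℂ := fun z => z - c
  have hdiff : Differentiable ℂ n := by fun_prop
  obtain ⟨F, hF⟩ := exists_isUpperPrimitive_branchQuot hdiff (bandEdges δ α)
  have hnum : (fun z => n z * z / z ^ 2 - 1) =O[upperInfty] fun z => z⁻¹ := by
    refine (Asymptotics.isBigO_const_mul_self (-(c : ℂ)) (fun z : ℂ => z⁻¹) upperInfty).congr'
      ?_ EventuallyEq.rfl
    filter_upwards [eventually_upperInfty_im_pos] with z hz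
    have := ne_zero_of_im_pos hz
    simp only [n]
    field_simp
    ring
  refine exists_isGreenAtInfty hF (branchQuot_sub_inv_isBigO (m := 2) (card_bandEdges hδ hα) hnum)
    (isClosed_Icc.sdiff isOpen_Ioo) (bandEdges δ α).countable_toSet (bandEdges_subset hδ hα)
    (fun x hx => analyticAt_branchQuot hdiff hx) (fun x hx => ?_) sdiff_subset
    (continuous_gapGreen (continuous_gapDensity hδ hα _)).continuousOn
    (fun x hx => hasDerivAt_gapGreen_re_branchQuot hδ hα hx) fun x hx => ?_
  · obtain ⟨j, hj⟩ := even_card_filter_lt_bandEdges hδ hα hx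
    rw [branchQuot_ofReal_of_even (n := n) (Complex.ofReal_sub x c).symm
      (hj.trans (two_mul j).symm), Complex.ofReal_im]
  · rcases le_or_gt x (α - δ) with hleft | hleft
    · exact gapGreen_of_le hδ hα hleft
    · exact gapGreen_of_ge hδ (not_lt.1 fun hright => hx.2 ⟨hleft, hright⟩)

lemma greenTwo_eq_gapGreen (hδ : 0 < δ) (hα : α ∈ Ioo (δ - 1) (1 - δ)) (hx : x ∈ Icc (-1 : ℝ) 1) :
    greenTwo α δ x = gapGreen δ (critOffset δ α) α x := by
  obtain ⟨g, hg, hgx⟩ := exists_isGreenAtInfty_twoIntervals hδ hα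
  have hne : (twoIntervals α δ).Nonempty :=
    ⟨_, 1, ⟨by norm_num, fun h => by linarith [h.2, hα.2]⟩, rfl⟩
  rw [greenTwo, hg.greenAtInfty_eq hne, hgx x hx]

lemma gapDensity_left_eq (hδ : 0 < δ) (φ : ℝ) :
    gapDensity δ (-δ) (δ - 1) φ =
      √(δ * (1 - Real.cos φ)) / √(2 - δ + δ * Real.cos φ) := by
  have hnonneg : 0 ≤ δ * (1 - Real.cos φ) := mul_nonneg hδ.le (by linarith [Real.cos_le_one φ])
  have hfactor : 1 - (δ - 1 - δ * Real.cos φ) ^ 2 =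
      δ * (1 - Real.cos φ) * (2 - δ + δ * Real.cos φ) := by ring
  rw [gapDensity, gapWeight, hfactor, Real.sqrt_mul hnonneg, mul_inv, ← mul_assoc,
    ← div_eq_mul_inv, ← div_eq_mul_inv, neg_add, neg_neg, ← sub_eq_add_neg, ← mul_one_sub,
    Real.div_sqrt]

lemma continuous_gapDensity_left (hδ : 0 < δ) (hδ1 : δ < 1) :
    Continuous (gapDensity δ (-δ) (δ - 1)) := by
  rw [funext (gapDensity_left_eq hδ)]
  refine Continuous.div (by fun_prop) (by fun_prop) fun φ => (Real.sqrt_pos.2 ?_).ne'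
  nlinarith [Real.neg_one_le_cos φ]

lemma hasDerivAt_gapGreen_left (hδ : 0 < δ) (hδ1 : δ < 1)
    (hx : x ∈ Ioo (-1) 1 \ (({-1 + 2 * δ, 1} : Finset ℝ) : Set ℝ)) :
    HasDerivAt (gapGreen δ (-δ) (δ - 1)) (branchQuot (fun _ => 1) {-1 + 2 * δ, 1} x).re x := by
  obtain ⟨⟨hx1, hx2⟩, hedge⟩ := hx
  simp only [Finset.coe_insert, Finset.coe_singleton, mem_insert_iff, mem_singleton_iff,
    not_or] at hedge
  have hne : -1 + 2 * δ ≠ 1 := by linarith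
  rcases lt_or_gt_of_ne hedge.1 with hright | hright
  · have hcard : (({-1 + 2 * δ, 1} : Finset ℝ).filter (x < ·)).card = 2 * 1 := by
      rw [Finset.card_filter, Finset.sum_pair hne, if_pos hright, if_pos hx2]
    have hpos : 0 < √(x + 1) := Real.sqrt_pos.2 (by linarith)
    convert! hasDerivAt_gapGreen hδ (continuous_gapDensity_left hδ hδ1) (x := x)
      ⟨by linarith, by linarith⟩ hx1 using 1
    rw [branchQuot_ofReal_of_even Complex.ofReal_one.symm hcard, Complex.ofReal_re,
      Finset.prod_pair hne, abs_sub_comm x, abs_of_pos (sub_pos.2 hright), abs_sub_comm x,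
      abs_of_pos (sub_pos.2 hx2),
      show δ - 1 + -δ - x = -(√(x + 1) * √(x + 1)) by
        rw [Real.mul_self_sqrt (by linarith)]; ring,
      show x - (δ - 1 - δ) = x + 1 by ring, show δ - 1 + δ - x = -1 + 2 * δ - x by ring]
    field_simp
  · have hcard : (({-1 + 2 * δ, 1} : Finset ℝ).filter (x < ·)).card = 1 := by
      rw [Finset.card_filter, Finset.sum_pair hne, if_neg hright.not_gt, if_pos hx2]
    rw [re_branchQuot_ofReal_of_odd Complex.ofReal_one.symm (hcard.symm ▸ odd_one)]
    exact hasDerivAt_gapGreen_of_gt hδ (by linarith)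

lemma exists_isGreenAtInfty_oneInterval (hδ : 0 < δ) (hδ1 : δ < 1) :
    ∃ g, IsGreenAtInfty (oneInterval δ) g ∧
      ∀ x ∈ Icc (-1 : ℝ) 1, g x = gapGreen δ (-δ) (δ - 1) x := by
  have hne : -1 + 2 * δ ≠ 1 := by linarith
  have hdiff : Differentiable ℂ fun _ : ℂ => (1 : ℂ) := differentiable_const 1
  obtain ⟨F, hF⟩ := exists_isUpperPrimitive_branchQuot hdiff {-1 + 2 * δ, 1}
  have hnum : (fun z : ℂ => 1 * z / z ^ 1 - 1) =O[upperInfty] fun z => z⁻¹ := by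
    refine (Asymptotics.isBigO_zero (fun z : ℂ => z⁻¹) upperInfty).congr' ?_ EventuallyEq.rfl
    filter_upwards [eventually_upperInfty_im_pos] with z hz
    rw [one_mul, pow_one, div_self (ne_zero_of_im_pos hz), sub_self]
  refine exists_isGreenAtInfty hF (branchQuot_sub_inv_isBigO (m := 1) (Finset.card_pair hne) hnum)
    isClosed_Icc ({-1 + 2 * δ, 1} : Finset ℝ).countable_toSet ?_
    (fun x hx => analyticAt_branchQuot hdiff hx) (fun x hx => ?_)
    (Icc_subset_Icc_left (by linarith))
    (continuous_gapGreen (continuous_gapDensity_left hδ hδ1)).continuousOn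
    (fun x hx => hasDerivAt_gapGreen_left hδ hδ1 hx)
    fun x hx => gapGreen_of_ge hδ (by linarith [hx.1])
  · simp only [Finset.coe_insert, Finset.coe_singleton, insert_subset_iff, singleton_subset_iff]
    exact ⟨⟨le_rfl, by linarith⟩, ⟨by linarith, le_rfl⟩⟩
  · obtain ⟨j, hj⟩ : Even (({-1 + 2 * δ, 1} : Finset ℝ).filter (x < ·)).card := by
      rw [Finset.card_filter, Finset.sum_pair hne]
      rcases lt_or_ge x (-1 + 2 * δ) with hleft | hleft
      · rw [if_pos hleft, if_pos (by linarith)]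
        decide
      · rw [if_neg hleft.not_gt, if_neg fun hright => hx ⟨hleft, hright.le⟩]
        decide
    rw [branchQuot_ofReal_of_even Complex.ofReal_one.symm (hj.trans (two_mul j).symm),
      Complex.ofReal_im]

lemma greenOne_eq_gapGreen (hδ : 0 < δ) (hδ1 : δ < 1) (hx : x ∈ Icc (-1 : ℝ) 1) :
    greenOne δ x = gapGreen δ (-δ) (δ - 1) x := by
  obtain ⟨g, hg, hgx⟩ := exists_isGreenAtInfty_oneInterval hδ hδ1
  have hne : (oneInterval δ).Nonempty := ⟨_, 1, ⟨by linarith, le_rfl⟩, rfl⟩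
  rw [greenOne, hg.greenAtInfty_eq hne, hgx x hx]

end Identification

/-! ### The derivative in the centre of the gap -/

/-- The derivative of `greenTwo α δ x` in `α`, at the point `x = α - δ cos θ` of the gap. -/
noncomputable def gapGreenDeriv (δ α θ : ℝ) : ℝ :=
  (∫ φ in θ..Real.pi, gapDensityDeriv δ (critOffset δ α) α φ) -
    critOffsetDeriv δ α * (∫ φ in θ..Real.pi, gapWeight δ α φ) +
    gapDensity δ (critOffset δ α) α θ / (δ * Real.sin θ)

section Derivative

variable {δ α x θ : ℝ}

lemma mem_Icc_of_mem_gap (hα : α ∈ Ioo (δ - 1) (1 - δ)) (hx : x ∈ Ioo (α - δ) (α + δ)) :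
    x ∈ Icc (-1 : ℝ) 1 :=
  ⟨by linarith [hα.1, hx.1], by linarith [hα.2, hx.2]⟩

/-- Freezing `γ = critOffset δ α` leaves the variation of `critOffset` as a separate factor, which
vanishes at `α` itself. -/
lemma hasDerivAt_greenTwo (hδ : 0 < δ) (hα : α ∈ Ioo (δ - 1) (1 - δ))
    (hx : x ∈ Ioo (α - δ) (α + δ)) :
    HasDerivAt (fun β => greenTwo β δ x) (gapGreenDeriv δ α (gapAngle δ α x)) α := by
  set γ := critOffset δ α with hγ
  have hangle := hasDerivAt_gapAngle_center hδ hx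
  have hdensity := hasDerivAt_integral_left_parametric isOpen_Ioo (continuousOn_gapDensity hδ γ)
    (continuousOn_gapDensityDeriv hδ γ) (fun β hβ φ => hasDerivAt_gapDensity hδ hβ γ φ) hα hangle
    Real.pi
  have hweight := hasDerivAt_integral_left_parametric isOpen_Ioo (continuousOn_gapWeight hδ)
    (continuousOn_gapWeightDeriv hδ) (fun β hβ φ => hasDerivAt_gapWeight hδ hβ φ) hα hangle Real.pi
  have hsplit : (fun β => greenTwo β δ x) =ᶠ[𝓝 α] fun β =>
      (∫ φ in gapAngle δ β x..Real.pi, gapDensity δ γ β φ) -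
        (critOffset δ β - γ) * ∫ φ in gapAngle δ β x..Real.pi, gapWeight δ β φ := by
    filter_upwards [isOpen_Ioo.mem_nhds hα] with β hβ
    rw [greenTwo_eq_gapGreen hδ hβ (mem_Icc_of_mem_gap hα hx), gapGreen,
      ← integral_gapDensity_sub hδ hβ, sub_sub_cancel]
  refine HasDerivAt.congr_of_eventuallyEq ?_ hsplit
  convert! hdensity.sub (((hasDerivAt_critOffset hδ hα).sub_const γ).mul hweight) using 1
  rw [gapGreenDeriv, ← hγ, sub_self, zero_mul, add_zero]
  ring

lemma hasDerivAt_gapGreenDeriv (hδ : 0 < δ) (hα : α ∈ Ioo (δ - 1) (1 - δ))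
    (hθ : θ ∈ Ioo 0 Real.pi) :
    HasDerivAt (gapGreenDeriv δ α) (gapWeight δ α θ * (critOffsetDeriv δ α +
      (δ + critOffset δ α * Real.cos θ) / (δ * Real.sin θ ^ 2))) θ := by
  set γ := critOffset δ α
  have hsin := (Real.sin_pos_of_mem_Ioo hθ).ne'
  have hnum : HasDerivAt (gapDensity δ γ α) (δ * Real.sin θ * gapWeight δ α θ +
      -(γ + δ * Real.cos θ) * (gapWeightDeriv δ α θ * (δ * Real.sin θ))) θ := by
    have hfactor : HasDerivAt (fun φ => -(γ + δ * Real.cos φ)) (δ * Real.sin θ) θ := by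
      convert! (((Real.hasDerivAt_cos θ).const_mul δ).const_add γ).neg using 1
      ring
    exact hfactor.mul (hasDerivAt_gapWeight_angle hδ hα θ)
  have hquot := hnum.div ((Real.hasDerivAt_sin θ).const_mul δ) (mul_ne_zero hδ.ne' hsin)
  have hintegrals := (hasDerivAt_integral_left (continuous_gapDensityDeriv hδ hα γ) θ Real.pi).sub
    ((hasDerivAt_integral_left (continuous_gapWeight hδ hα) θ Real.pi).const_mul
      (critOffsetDeriv δ α))
  convert! hintegrals.add hquot using 1
  rw [gapDensityDeriv, gapDensity]
  field_simp
  linear_combination -(gapWeight δ α θ * δ) * Real.sin_sq_add_cos_sq θ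

lemma strictMonoOn_gapGreenDeriv (hδ : 0 < δ) (hα : α ∈ Ioo (δ - 1) (1 - δ)) :
    StrictMonoOn (gapGreenDeriv δ α) (Ioo 0 Real.pi) := by
  refine strictMonoOn_of_hasDerivWithinAt_pos (convex_Ioo _ _)
    (fun θ hθ => (hasDerivAt_gapGreenDeriv hδ hα hθ).continuousAt.continuousWithinAt)
    (fun θ hθ => (hasDerivAt_gapGreenDeriv hδ hα (interior_subset hθ)).hasDerivWithinAt)
    fun θ hθ => mul_pos (gapWeight_pos hδ hα θ) ?_
  replace hθ := interior_subset hθ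
  have hsin := Real.sin_pos_of_mem_Ioo hθ
  have hnum : 0 < δ + critOffset δ α * Real.cos θ := by
    nlinarith [neg_lt_critOffset hδ hα, critOffset_lt hδ hα, neg_one_lt_cos_of_mem_Ioo hθ,
      cos_lt_one_of_mem_Ioo hθ]
  exact add_pos_of_nonneg_of_pos (critOffsetDeriv_nonneg hδ hα) (by positivity)

lemma gapDensity_zero_neg (hδ : 0 < δ) (hα : α ∈ Ioo (δ - 1) (1 - δ)) :
    gapDensity δ (critOffset δ α) α 0 < 0 := by
  rw [gapDensity, Real.cos_zero, mul_one]
  exact mul_neg_of_neg_of_pos (by linarith [neg_lt_critOffset hδ hα]) (gapWeight_pos hδ hα 0)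

lemma gapDensity_pi_pos (hδ : 0 < δ) (hα : α ∈ Ioo (δ - 1) (1 - δ)) :
    0 < gapDensity δ (critOffset δ α) α Real.pi := by
  rw [gapDensity, Real.cos_pi]
  exact mul_pos (by linarith [critOffset_lt hδ hα]) (gapWeight_pos hδ hα _)

lemma exists_gapGreenDeriv_eq_zero (hδ : 0 < δ) (hα : α ∈ Ioo (δ - 1) (1 - δ)) :
    ∃ θ ∈ Ioo 0 Real.pi, gapGreenDeriv δ α θ = 0 := by
  set γ := critOffset δ α with hγ
  set m : ℝ → ℝ := fun θ => δ * Real.sin θ *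
    ((∫ φ in θ..Real.pi, gapDensityDeriv δ γ α φ) -
      critOffsetDeriv δ α * ∫ φ in θ..Real.pi, gapWeight δ α φ) + gapDensity δ γ α θ with hm
  have hcont : Continuous m := by
    have hdensity := continuous_integral_left (continuous_gapDensityDeriv hδ hα γ) Real.pi
    have hweight := continuous_integral_left (continuous_gapWeight hδ hα) Real.pi
    have hboundary := continuous_gapDensity hδ hα γ
    fun_prop
  have hzero : m 0 = gapDensity δ γ α 0 := by
    simp only [hm, Real.sin_zero, mul_zero, zero_mul, zero_add]
  have hpi : m Real.pi = gapDensity δ γ α Real.pi := by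
    simp only [hm, Real.sin_pi, mul_zero, zero_mul, zero_add]
  obtain ⟨θ, hθ, hmθ⟩ := intermediate_value_Ioo Real.pi_pos.le hcont.continuousOn
    (show (0 : ℝ) ∈ Ioo (m 0) (m Real.pi) from
      ⟨hzero ▸ gapDensity_zero_neg hδ hα, hpi ▸ gapDensity_pi_pos hδ hα⟩)
  have hsin := (mul_pos hδ (Real.sin_pos_of_mem_Ioo hθ)).ne'
  refine ⟨θ, hθ, (mul_eq_zero.1 ?_).resolve_left hsin⟩
  rw [gapGreenDeriv, ← hγ, mul_add, mul_div_cancel₀ _ hsin]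
  exact hmθ

lemma strictMonoOn_deriv_greenTwo (hδ : 0 < δ) (hα : α ∈ Ioo (δ - 1) (1 - δ)) :
    StrictMonoOn (fun x => deriv (fun β => greenTwo β δ x) α) (Ioo (α - δ) (α + δ)) := by
  intro x hx y hy hxy
  simp only [(hasDerivAt_greenTwo hδ hα hx).deriv, (hasDerivAt_greenTwo hδ hα hy).deriv]
  refine strictMonoOn_gapGreenDeriv hδ hα (gapAngle_mem_Ioo hδ hx) (gapAngle_mem_Ioo hδ hy) ?_
  refine Real.strictAntiOn_arccos (Ioo_subset_Icc_self (div_mem_Ioo_of_mem_gap hδ hy))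
    (Ioo_subset_Icc_self (div_mem_Ioo_of_mem_gap hδ hx)) ?_
  gcongr

lemma existsUnique_deriv_greenTwo_eq_zero (hδ : 0 < δ) (hα : α ∈ Ioo (δ - 1) (1 - δ)) :
    ∃! x, x ∈ Ioo (α - δ) (α + δ) ∧ deriv (fun β => greenTwo β δ x) α = 0 := by
  obtain ⟨θ, hθ, hzero⟩ := exists_gapGreenDeriv_eq_zero hδ hα
  have hgap : α - δ * Real.cos θ ∈ Ioo (α - δ) (α + δ) := by
    constructor <;> nlinarith [neg_one_lt_cos_of_mem_Ioo hθ, cos_lt_one_of_mem_Ioo hθ]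
  have hderiv : deriv (fun β => greenTwo β δ (α - δ * Real.cos θ)) α = 0 := by
    rw [(hasDerivAt_greenTwo hδ hα hgap).deriv,
      gapAngle_sub_mul_cos hδ α (Ioo_subset_Icc_self hθ), hzero]
  exact ⟨_, ⟨hgap, hderiv⟩, fun y hy =>
    (strictMonoOn_deriv_greenTwo hδ hα).injOn hy.1 hgap (hy.2.trans hderiv.symm)⟩

end Derivative

/-! ### Symmetry and positivity -/

section Symmetry

variable {δ α : ℝ}

lemma gapWeight_neg_pi_sub (δ α φ : ℝ) : gapWeight δ (-α) (Real.pi - φ) = gapWeight δ α φ := by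
  rw [gapWeight, gapWeight, Real.cos_pi_sub]
  congr 3
  ring

lemma gapDensity_neg_pi_sub (δ γ α φ : ℝ) :
    gapDensity δ (-γ) (-α) (Real.pi - φ) = -gapDensity δ γ α φ := by
  rw [gapDensity, gapDensity, gapWeight_neg_pi_sub, Real.cos_pi_sub]
  ring

lemma integral_gapDensity_neg (δ γ α θ : ℝ) :
    ∫ φ in (Real.pi - θ)..Real.pi, gapDensity δ (-γ) (-α) φ =
      -∫ φ in 0..θ, gapDensity δ γ α φ := by
  rw [← intervalIntegral.integral_neg]
  simp only [← gapDensity_neg_pi_sub]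
  rw [intervalIntegral.integral_comp_sub_left (gapDensity δ (-γ) (-α)), sub_zero]

lemma critOffset_neg (δ α : ℝ) : critOffset δ (-α) = -critOffset δ α := by
  have hdensity := integral_gapDensity_neg δ 0 α Real.pi
  have hweight := intervalIntegral.integral_comp_sub_left (gapWeight δ (-α)) (a := 0)
    (b := Real.pi) Real.pi
  simp only [gapWeight_neg_pi_sub, sub_self, sub_zero] at hweight
  rw [neg_zero, sub_self] at hdensity
  rw [critOffset, critOffset, hdensity, ← hweight, neg_div]

lemma integral_gapDensity_eq_neg (hδ : 0 < δ) (hα : α ∈ Ioo (δ - 1) (1 - δ)) (θ : ℝ) :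
    ∫ φ in θ..Real.pi, gapDensity δ (critOffset δ α) α φ =
      -∫ φ in 0..θ, gapDensity δ (critOffset δ α) α φ := by
  have hcont := continuous_gapDensity hδ hα (critOffset δ α)
  rw [eq_neg_iff_add_eq_zero, add_comm, intervalIntegral.integral_add_adjacent_intervals
    (hcont.intervalIntegrable _ _) (hcont.intervalIntegrable _ _),
    integral_gapDensity_critOffset hδ hα]

lemma greenTwo_neg_zero (hδ : 0 < δ) (hα : α ∈ Ioo (δ - 1) (1 - δ)) :
    greenTwo (-α) δ 0 = greenTwo α δ 0 := by
  have hα' : -α ∈ Ioo (δ - 1) (1 - δ) := ⟨by linarith [hα.2], by linarith [hα.1]⟩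
  have hangle : gapAngle δ (-α) 0 = Real.pi - gapAngle δ α 0 := by
    rw [gapAngle, gapAngle, ← Real.arccos_neg, sub_zero, sub_zero, neg_div]
  rw [greenTwo_eq_gapGreen hδ hα (by simp), greenTwo_eq_gapGreen hδ hα' (by simp), gapGreen,
    gapGreen, hangle, critOffset_neg, integral_gapDensity_neg, integral_gapDensity_eq_neg hδ hα]

lemma deriv_greenTwo_zero_zero (hδ : 0 < δ) (hδ1 : δ < 1) :
    deriv (fun β => greenTwo β δ 0) 0 = 0 := by
  have hmem : (0 : ℝ) ∈ Ioo (δ - 1) (1 - δ) := ⟨by linarith, by linarith⟩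
  have heven : (fun β => greenTwo (-β) δ 0) =ᶠ[𝓝 0] fun β => greenTwo β δ 0 := by
    filter_upwards [isOpen_Ioo.mem_nhds hmem] with β hβ using greenTwo_neg_zero hδ hβ
  have hneg := heven.deriv_eq
  rw [deriv_comp_neg (fun β => greenTwo β δ 0), neg_zero] at hneg
  linarith

end Symmetry

section Positivity

variable {δ α x θ : ℝ}

lemma greenTwo_eq_zero (hδ : 0 < δ) (hα : α ∈ Ioo (δ - 1) (1 - δ)) (hx : x ∈ Icc (-1 : ℝ) 1)
    (hgap : x ∉ Ioo (α - δ) (α + δ)) : greenTwo α δ x = 0 := by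
  rw [greenTwo_eq_gapGreen hδ hα hx]
  rcases le_or_gt x (α - δ) with hleft | hleft
  · exact gapGreen_of_le hδ hα hleft
  · exact gapGreen_of_ge hδ (not_lt.1 fun hright => hgap ⟨hleft, hright⟩)

/-- The density changes sign once, from negative to positive, and has integral zero over
`[0, π]`. -/
lemma integral_gapDensity_critOffset_pos (hδ : 0 < δ) (hα : α ∈ Ioo (δ - 1) (1 - δ))
    (hθ : θ ∈ Ioo 0 Real.pi) : 0 < ∫ φ in θ..Real.pi, gapDensity δ (critOffset δ α) α φ := by
  have hcont := continuous_gapDensity hδ hα (critOffset δ α)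
  rcases le_or_gt (critOffset δ α + δ * Real.cos θ) 0 with hsign | hsign
  · refine intervalIntegral.intervalIntegral_pos_of_pos_on (hcont.intervalIntegrable _ _)
      (fun φ hφ => mul_pos ?_ (gapWeight_pos hδ hα φ)) hθ.2
    nlinarith [Real.cos_lt_cos_of_nonneg_of_le_pi hθ.1.le hφ.2.le hφ.1]
  · rw [integral_gapDensity_eq_neg hδ hα, ← intervalIntegral.integral_neg]
    refine intervalIntegral.intervalIntegral_pos_of_pos_on (hcont.neg.intervalIntegrable _ _)
      (fun φ hφ => ?_) hθ.1
    rw [gapDensity, neg_mul, neg_neg]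
    refine mul_pos ?_ (gapWeight_pos hδ hα φ)
    nlinarith [Real.cos_lt_cos_of_nonneg_of_le_pi hφ.1.le hθ.2.le hφ.2]

lemma greenTwo_pos (hδ : 0 < δ) (hα : α ∈ Ioo (δ - 1) (1 - δ)) (hx : x ∈ Ioo (α - δ) (α + δ)) :
    0 < greenTwo α δ x := by
  rw [greenTwo_eq_gapGreen hδ hα (mem_Icc_of_mem_gap hα hx)]
  exact integral_gapDensity_critOffset_pos hδ hα (gapAngle_mem_Ioo hδ hx)

end Positivity

/-! ### Continuity in the centre of the gap and the limit `α → δ - 1` -/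

section Continuity

open Function (uncurry)

variable {δ α x : ℝ}

lemma continuous_gapAngle_center (δ x : ℝ) : Continuous fun β => gapAngle δ β x := by
  unfold gapAngle
  fun_prop

lemma continuousOn_gapDensity_critOffset (hδ : 0 < δ) :
    ContinuousOn (uncurry fun β => gapDensity δ (critOffset δ β) β)
      (Ioo (δ - 1) (1 - δ) ×ˢ univ) := by
  have hcrit : ContinuousOn (critOffset δ) (Ioo (δ - 1) (1 - δ)) := fun β hβ =>
    (hasDerivAt_critOffset hδ hβ).continuousAt.continuousWithinAt
  have hfactor : ContinuousOn (fun p : ℝ × ℝ => -(critOffset δ p.1 + δ * Real.cos p.2))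
      (Ioo (δ - 1) (1 - δ) ×ˢ univ) :=
    ((hcrit.comp continuousOn_fst fun _ hp => hp.1).add (by fun_prop)).neg
  exact hfactor.mul (continuousOn_gapWeight hδ)

lemma continuousAt_greenTwo (hδ : 0 < δ) (hα : α ∈ Ioo (δ - 1) (1 - δ))
    (hx : x ∈ Icc (-1 : ℝ) 1) : ContinuousAt (fun β => greenTwo β δ x) α := by
  have hnhds : Ioo (δ - 1) (1 - δ) ×ˢ univ ∈ 𝓝 (α, gapAngle δ α x) :=
    (isOpen_Ioo.prod isOpen_univ).mem_nhds ⟨hα, mem_univ _⟩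
  have hgreen : ContinuousAt (fun β => gapGreen δ (critOffset δ β) β x) α :=
    ((continuousOn_integral_left_parametric (continuousOn_gapDensity_critOffset hδ)
      Real.pi).continuousAt hnhds).comp (f := fun β => (β, gapAngle δ β x))
      (continuousAt_id.prodMk (continuous_gapAngle_center δ x).continuousAt)
  refine hgreen.congr ?_
  filter_upwards [isOpen_Ioo.mem_nhds hα] with β hβ using (greenTwo_eq_gapGreen hδ hβ hx).symm

end Continuity

section LeftEnd

variable {δ α x φ : ℝ}

lemma inv_add_le_gapWeight (hδ : 0 < δ) (hα : α ∈ Ioo (δ - 1) (1 - δ)) (hφ : 0 ≤ φ) :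
    (√(2 * (1 + α - δ)) + φ)⁻¹ ≤ gapWeight δ α φ := by
  have hx := gapPoint_mem_Ioo hδ hα φ
  set s := √(2 * (1 + α - δ))
  have hs : 0 ≤ s := Real.sqrt_nonneg _
  have hsq : s ^ 2 = 2 * (1 + α - δ) := Real.sq_sqrt (by linarith [hα.1])
  refine inv_anti₀ (Real.sqrt_pos.2 (one_sub_sq_pos hx)) (Real.sqrt_le_left (by linarith) |>.2 ?_)
  have hδ1 : δ ≤ 1 := by linarith [hα.1, hα.2]
  have hcos : δ * (1 - Real.cos φ) ≤ φ ^ 2 / 2 := by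
    nlinarith [Real.cos_le_one φ, Real.one_sub_sq_div_two_le_cos (x := φ)]
  calc 1 - (α - δ * Real.cos φ) ^ 2 ≤ 2 * (1 + (α - δ * Real.cos φ)) := by
        nlinarith [sq_nonneg (1 + (α - δ * Real.cos φ))]
    _ = s ^ 2 + 2 * (δ * (1 - Real.cos φ)) := by rw [hsq]; ring
    _ ≤ (s + φ) ^ 2 := by nlinarith [mul_nonneg hs hφ]

lemma integral_inv_const_add {s c : ℝ} (hs : 0 < s) (hc : 0 < c) :
    ∫ φ in 0..c, (s + φ)⁻¹ = Real.log ((s + c) / s) := by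
  rw [intervalIntegral.integral_comp_add_left (fun t : ℝ => t⁻¹) s, add_zero,
    integral_inv_of_pos hs (by linarith)]

lemma log_le_integral_gapWeight (hδ : 0 < δ) (hα : α ∈ Ioo (δ - 1) (1 - δ)) :
    Real.log ((√(2 * (1 + α - δ)) + Real.pi) / √(2 * (1 + α - δ))) ≤
      ∫ φ in 0..Real.pi, gapWeight δ α φ := by
  have hs : 0 < √(2 * (1 + α - δ)) := Real.sqrt_pos.2 (by linarith [hα.1])
  rw [← integral_inv_const_add hs Real.pi_pos]
  refine intervalIntegral.integral_mono_on Real.pi_pos.le (ContinuousOn.intervalIntegrable ?_)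
    ((continuous_gapWeight hδ hα).intervalIntegrable _ _)
    fun φ hφ => inv_add_le_gapWeight hδ hα hφ.1
  rw [uIcc_of_le Real.pi_pos.le]
  exact ContinuousOn.inv₀ (by fun_prop) fun φ hφ => by linarith [hφ.1]

lemma tendsto_log_add_div_nhdsGT_zero {c : ℝ} (hc : 0 < c) :
    Tendsto (fun s : ℝ => Real.log ((s + c) / s)) (𝓝[>] 0) atTop := by
  have hquot : Tendsto (fun s : ℝ => 1 + c * s⁻¹) (𝓝[>] 0) atTop :=
    tendsto_atTop_add_const_left _ _ (tendsto_inv_nhdsGT_zero.const_mul_atTop hc)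
  refine Real.tendsto_log_atTop.comp (hquot.congr' ?_)
  filter_upwards [self_mem_nhdsWithin] with s hs
  rw [add_div, div_self (ne_of_gt hs), div_eq_mul_inv]

lemma tendsto_integral_gapWeight (hδ : 0 < δ) (hδ1 : δ < 1) :
    Tendsto (fun β => ∫ φ in 0..Real.pi, gapWeight δ β φ) (𝓝[>] (δ - 1)) atTop := by
  have hsqrt : Tendsto (fun β => √(2 * (1 + β - δ))) (𝓝[>] (δ - 1)) (𝓝[>] 0) := by
    refine tendsto_nhdsWithin_iff.2 ⟨Tendsto.mono_left ?_ nhdsWithin_le_nhds, ?_⟩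
    · exact (Continuous.tendsto' (by fun_prop) _ _ (by simp))
    · filter_upwards [self_mem_nhdsWithin] with β hβ
      exact Real.sqrt_pos.2 (by linarith [mem_Ioi.1 hβ])
  refine tendsto_atTop_mono' _ ?_ ((tendsto_log_add_div_nhdsGT_zero Real.pi_pos).comp hsqrt)
  filter_upwards [Ioo_mem_nhdsGT (show δ - 1 < 1 - δ by linarith)] with β hβ
  exact log_le_integral_gapWeight hδ hβ

lemma mul_one_sub_cos_le_radicand (hδ : 0 < δ) (hδ1 : δ < 1) (hα : α ∈ Icc (δ - 1) 0) (φ : ℝ) :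
    (1 - δ) * (δ * (1 - Real.cos φ)) ≤ 1 - (α - δ * Real.cos φ) ^ 2 := by
  have hleft : δ * (1 - Real.cos φ) ≤ 1 + (α - δ * Real.cos φ) := by linarith [hα.1]
  have hright : 1 - δ ≤ 1 - (α - δ * Real.cos φ) := by
    nlinarith [hα.2, Real.neg_one_le_cos φ]
  calc (1 - δ) * (δ * (1 - Real.cos φ))
      ≤ (1 - (α - δ * Real.cos φ)) * (1 + (α - δ * Real.cos φ)) :=
        mul_le_mul hright hleft (mul_nonneg hδ.le (by linarith [Real.cos_le_one φ])) (by linarith)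
    _ = 1 - (α - δ * Real.cos φ) ^ 2 := by ring

lemma mul_one_sub_cos_le_radicand_of_le (hδ : 0 < δ) (hδ1 : δ < 1) (hα : α ∈ Icc (δ - 1) 0)
    {ψ : ℝ} (hψ : 0 ≤ ψ) (hψφ : ψ ≤ φ) (hφ : φ ≤ Real.pi) :
    (1 - δ) * (δ * (1 - Real.cos ψ)) ≤ 1 - (α - δ * Real.cos φ) ^ 2 := by
  have hcos := Real.cos_le_cos_of_nonneg_of_le_pi hψ hφ hψφ
  refine (mul_le_mul_of_nonneg_left ?_ (sub_pos.2 hδ1).le).trans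
    (mul_one_sub_cos_le_radicand hδ hδ1 hα φ)
  exact mul_le_mul_of_nonneg_left (sub_le_sub_left hcos 1) hδ.le

lemma gapDensity_neg_le (hδ : 0 < δ) (hδ1 : δ < 1) (hα : α ∈ Icc (δ - 1) 0) (φ : ℝ) :
    gapDensity δ (-δ) α φ ≤ (1 - δ)⁻¹ := by
  rw [← one_div, le_div_iff₀ (sub_pos.2 hδ1)]
  calc gapDensity δ (-δ) α φ * (1 - δ)
      = (1 - δ) * (δ * (1 - Real.cos φ)) * gapWeight δ α φ := by rw [gapDensity]; ring
    _ ≤ (1 - (α - δ * Real.cos φ) ^ 2) * gapWeight δ α φ :=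
        mul_le_mul_of_nonneg_right (mul_one_sub_cos_le_radicand hδ hδ1 hα φ)
          (gapWeight_nonneg δ α φ)
    _ = √(1 - (α - δ * Real.cos φ) ^ 2) := by rw [gapWeight, ← div_eq_mul_inv, Real.div_sqrt]
    _ ≤ 1 := Real.sqrt_le_one.2 (by linarith [sq_nonneg (α - δ * Real.cos φ)])

/-- The density for `γ = -δ` stays bounded as `α → δ - 1` while the mass of the weight tends to
infinity. -/
lemma tendsto_critOffset (hδ : 0 < δ) (hδ1 : δ < 1) :
    Tendsto (critOffset δ) (𝓝[>] (δ - 1)) (𝓝 (-δ)) := by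
  have hbound : ∀ᶠ β in 𝓝[>] (δ - 1), critOffset δ β - -δ ≤
      Real.pi * (1 - δ)⁻¹ / ∫ φ in 0..Real.pi, gapWeight δ β φ := by
    filter_upwards [Ioo_mem_nhdsGT (show δ - 1 < 0 by linarith)] with β hβ
    have hβ' : β ∈ Ioo (δ - 1) (1 - δ) := ⟨hβ.1, by linarith [hβ.2]⟩
    rw [critOffset_sub hδ hβ']
    refine div_le_div_of_nonneg_right ?_ (integral_gapWeight_pos hδ hβ').le
    have hmono := intervalIntegral.integral_mono (μ := MeasureTheory.volume) Real.pi_pos.le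
      ((continuous_gapDensity hδ hβ' (-δ)).intervalIntegrable _ _) intervalIntegrable_const
      (gapDensity_neg_le hδ hδ1 (Ioo_subset_Icc_self hβ))
    rwa [intervalIntegral.integral_const, sub_zero, smul_eq_mul] at hmono
  have hnonneg : ∀ᶠ β in 𝓝[>] (δ - 1), 0 ≤ critOffset δ β - -δ := by
    filter_upwards [Ioo_mem_nhdsGT (show δ - 1 < 1 - δ by linarith)] with β hβ
    exact (sub_pos.2 (neg_lt_critOffset hδ hβ)).le
  exact tendsto_sub_nhds_zero_iff.1 <|
    squeeze_zero' hnonneg hbound ((tendsto_integral_gapWeight hδ hδ1).const_div_atTop _)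

lemma abs_gapDensity_critOffset_le (hδ : 0 < δ) (hα : α ∈ Ioo (δ - 1) (1 - δ)) {c : ℝ}
    (hc : 0 < c) (h : c ≤ 1 - (α - δ * Real.cos φ) ^ 2) :
    |gapDensity δ (critOffset δ α) α φ| ≤ 2 * δ * (√c)⁻¹ := by
  have hγ₁ := neg_lt_critOffset hδ hα
  have hγ₂ := critOffset_lt hδ hα
  rw [gapDensity, abs_mul, abs_neg, abs_of_nonneg (gapWeight_nonneg δ α φ)]
  refine mul_le_mul (abs_le.2 ?_) (gapWeight_le_inv_sqrt hc h) (gapWeight_nonneg _ _ _)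
    (by positivity)
  constructor <;> nlinarith [Real.neg_one_le_cos φ, Real.cos_le_one φ]

lemma continuousAt_gapWeight_center (h : 0 < 1 - (α - δ * Real.cos φ) ^ 2) :
    ContinuousAt (fun β => gapWeight δ β φ) α := by
  have hsqrt : ContinuousAt (fun β => √(1 - (β - δ * Real.cos φ) ^ 2)) α := by fun_prop
  exact hsqrt.inv₀ (Real.sqrt_pos.2 h).ne'

lemma tendsto_gapDensity_critOffset (hδ : 0 < δ) (hδ1 : δ < 1)
    (h : 0 < 1 - (δ - 1 - δ * Real.cos φ) ^ 2) :
    Tendsto (fun β => gapDensity δ (critOffset δ β) β φ) (𝓝[>] (δ - 1))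
      (𝓝 (gapDensity δ (-δ) (δ - 1) φ)) :=
  ((tendsto_critOffset hδ hδ1).add_const _).neg.mul
    ((continuousAt_gapWeight_center h).tendsto.mono_left nhdsWithin_le_nhds)

/-- The radicand degenerates only at the angle `0`, which is the left end `-1` of the gap, so that
bounded convergence applies on `[θ / 2, π]`, where `θ > 0` is the angle of `x`. -/
lemma tendsto_greenTwo (hδ : 0 < δ) (hδ1 : δ < 1) (hx : x ∈ Ioc (-1 : ℝ) 1) :
    Tendsto (fun β => greenTwo β δ x) (𝓝[>] (δ - 1)) (𝓝 (greenOne δ x)) := by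
  have hev : ∀ᶠ β in 𝓝[>] (δ - 1), β ∈ Ioo (δ - 1) 0 := Ioo_mem_nhdsGT (by linarith)
  have hIoo : ∀ {β}, β ∈ Ioo (δ - 1) 0 → β ∈ Ioo (δ - 1) (1 - δ) := fun hβ =>
    ⟨hβ.1, by linarith [hβ.2]⟩
  set θ := gapAngle δ (δ - 1) x with hθ
  have hθ_pos : 0 < θ := by
    rw [hθ, gapAngle, Real.arccos_pos, div_lt_one hδ]
    linarith [hx.1]
  have hθ_le : θ ≤ Real.pi := gapAngle_le_pi δ _ x
  set c := (1 - δ) * (δ * (1 - Real.cos (θ / 2)))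
  have hc_pos : 0 < c :=
    mul_pos (sub_pos.2 hδ1)
      (mul_pos hδ (sub_pos.2 (cos_lt_one_of_mem_Ioo ⟨by linarith, by linarith⟩)))
  have hrad : ∀ β ∈ Icc (δ - 1) 0, ∀ φ ∈ Icc (θ / 2) Real.pi,
      c ≤ 1 - (β - δ * Real.cos φ) ^ 2 := fun β hβ φ hφ =>
    mul_one_sub_cos_le_radicand_of_le hδ hδ1 hβ (by linarith) hφ.1 hφ.2
  rw [greenOne_eq_gapGreen hδ hδ1 (Ioc_subset_Icc_self hx)]
  refine Tendsto.congr' (f₁ := fun β => gapGreen δ (critOffset δ β) β x)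
    (hev.mono fun β hβ => (greenTwo_eq_gapGreen hδ (hIoo hβ) (Ioc_subset_Icc_self hx)).symm) ?_
  exact tendsto_integral_left_of_bounded (a := θ / 2)
    (hev.mono fun β hβ => continuous_gapDensity hδ (hIoo hβ) _)
    (((continuous_gapAngle_center δ x).tendsto _).mono_left nhdsWithin_le_nhds) (by linarith)
    (Eventually.of_forall fun β => gapAngle_le_pi δ β x) hθ_le
    (hev.mono fun β hβ φ hφ => abs_gapDensity_critOffset_le hδ (hIoo hβ) hc_pos
      (hrad β (Ioo_subset_Icc_self hβ) φ hφ))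
    fun φ hφ => tendsto_gapDensity_critOffset hδ hδ1
      (hc_pos.trans_le (hrad _ ⟨le_rfl, by linarith⟩ φ hφ))

end LeftEnd

/-! ### The upper envelope -/

section Supremum

variable {f : ℝ → ℝ} {a b L : ℝ}

lemma exists_isMaxOn_Ioc_or_forall_le (hab : a < b) (hf : ContinuousOn f (Ioc a b))
    (hL : Tendsto f (𝓝[>] a) (𝓝 L)) :
    (∃ t ∈ Ioc a b, IsMaxOn f (Ioc a b) t) ∨ ∀ t ∈ Ioc a b, f t ≤ L := by
  classical
  have hcont : ContinuousOn (Function.update f a L) (Icc a b) := by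
    rw [continuousOn_update_iff, Icc_sdiff_left]
    exact ⟨hf, fun _ => hL.mono_left (nhdsWithin_mono _ fun t ht => ht.1)⟩
  have heq : ∀ t ∈ Ioc a b, Function.update f a L t = f t := fun t ht =>
    Function.update_of_ne ht.1.ne' _ _
  obtain ⟨m, hm, hmax⟩ := isCompact_Icc.exists_isMaxOn (nonempty_Icc.2 hab.le) hcont
  have hle : ∀ t ∈ Ioc a b, f t ≤ Function.update f a L m := fun t ht =>
    heq t ht ▸ hmax (Ioc_subset_Icc_self ht)
  rcases hm.1.eq_or_lt with rfl | ham
  · exact Or.inr fun t ht => (hle t ht).trans_eq (Function.update_self _ _ _)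
  · exact Or.inl ⟨m, ⟨ham, hm.2⟩, fun t ht => (hle t ht).trans_eq (heq m ⟨ham, hm.2⟩)⟩

lemma bddAbove_image_Ioc_of_tendsto (hab : a < b) (hf : ContinuousOn f (Ioc a b))
    (hL : Tendsto f (𝓝[>] a) (𝓝 L)) : BddAbove (f '' Ioc a b) := by
  obtain ⟨m, -, hmax⟩ | hle := exists_isMaxOn_Ioc_or_forall_le hab hf hL
  · exact hmax.bddAbove
  · exact ⟨L, forall_mem_image.2 hle⟩

lemma sSup_image_Ioc_eq_of_tendsto (hab : a < b) (hf : ContinuousOn f (Ioc a b))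
    (hL : Tendsto f (𝓝[>] a) (𝓝 L)) (hne : ¬∃ t ∈ Ioc a b, f t = sSup (f '' Ioc a b)) :
    sSup (f '' Ioc a b) = L := by
  obtain ⟨m, hm, hmax⟩ | hle := exists_isMaxOn_Ioc_or_forall_le hab hf hL
  · have hgreatest : IsGreatest (f '' Ioc a b) (f m) :=
      ⟨mem_image_of_mem f hm, forall_mem_image.2 hmax⟩
    exact absurd ⟨m, hm, hgreatest.csSup_eq.symm⟩ hne
  · refine le_antisymm (csSup_le ((nonempty_Ioc.2 hab).image f) (forall_mem_image.2 hle))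
      (le_of_tendsto hL ?_)
    filter_upwards [Ioc_mem_nhdsGT hab] with t ht
    exact le_csSup (bddAbove_image_Ioc_of_tendsto hab hf hL) (mem_image_of_mem f ht)

lemma deriv_nonneg_of_isMaxOn_Ioc (hab : a < b) (hf : DifferentiableAt ℝ f b)
    (hmax : IsMaxOn f (Ioc a b) b) : 0 ≤ deriv f b := by
  refine ge_of_tendsto (hasDerivAt_iff_tendsto_slope_left_right.1 hf.hasDerivAt).1 ?_
  filter_upwards [Ioo_mem_nhdsLT hab] with t ht
  rw [slope_def_field]
  exact div_nonneg_of_nonpos (sub_nonpos.2 (hmax (Ioo_subset_Ioc_self ht)))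
    (sub_nonpos.2 ht.2.le)

end Supremum

section Envelope

variable {δ α x : ℝ}

lemma Ioc_subset_Ioo_of_lt_one (hδ1 : δ < 1) : Ioc (δ - 1) 0 ⊆ Ioo (δ - 1) (1 - δ) :=
  fun _ hα => ⟨hα.1, by linarith [hα.2]⟩

lemma exists_mem_gap (hδ : 0 < δ) (hδ1 : δ < 1) (hx : x ∈ Ioc (-1 : ℝ) 0) :
    ∃ α ∈ Ioc (δ - 1) 0, x ∈ Ioo (α - δ) (α + δ) := by
  have hlt : max (δ - 1) (x - δ) < min 0 (x + δ) :=
    max_lt (lt_min (by linarith) (by linarith [hx.1])) (lt_min (by linarith [hx.2]) (by linarith))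
  obtain ⟨α, hmax, hmin⟩ := exists_between hlt
  rw [max_lt_iff] at hmax
  rw [lt_min_iff] at hmin
  exact ⟨α, ⟨hmax.1, hmin.1.le⟩, by linarith [hmin.2], by linarith [hmax.2]⟩

lemma mem_gap_of_isMaxOn (hδ : 0 < δ) (hδ1 : δ < 1) (hx : x ∈ Ioc (-1 : ℝ) 0)
    (hα : α ∈ Ioc (δ - 1) 0) (hmax : IsMaxOn (fun β => greenTwo β δ x) (Ioc (δ - 1) 0) α) :
    x ∈ Ioo (α - δ) (α + δ) := by
  by_contra hgap
  obtain ⟨β, hβ, hxβ⟩ := exists_mem_gap hδ hδ1 hx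
  have hpos := greenTwo_pos hδ (Ioc_subset_Ioo_of_lt_one hδ1 hβ) hxβ
  have hzero := greenTwo_eq_zero hδ (Ioc_subset_Ioo_of_lt_one hδ1 hα)
    ⟨hx.1.le, by linarith [hx.2]⟩ hgap
  exact (hpos.trans_le (hmax hβ)).ne' hzero

/-- At the end point `α = 0` a maximum only gives `0 ≤ ∂_α G`; for `x < 0` this is excluded by
`∂_α G (x) < ∂_α G (0) = 0`. -/
lemma deriv_greenTwo_eq_zero_of_isMaxOn (hδ : 0 < δ) (hδ1 : δ < 1) (hx : x ≤ 0)
    (hα : α ∈ Ioc (δ - 1) 0) (hgap : x ∈ Ioo (α - δ) (α + δ))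
    (hmax : IsMaxOn (fun β => greenTwo β δ x) (Ioc (δ - 1) 0) α) :
    deriv (fun β => greenTwo β δ x) α = 0 := by
  rcases hα.2.eq_or_lt with rfl | hneg
  · have hzero := deriv_greenTwo_zero_zero hδ hδ1
    have hmem := Ioc_subset_Ioo_of_lt_one hδ1 hα
    refine le_antisymm ?_ (deriv_nonneg_of_isMaxOn_Ioc (by linarith)
      (hasDerivAt_greenTwo hδ hmem hgap).differentiableAt hmax)
    exact ((strictMonoOn_deriv_greenTwo hδ hmem).monotoneOn hgap
      ⟨by linarith, by linarith⟩ hx).trans_eq hzero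
  · exact (hmax.isLocalMax (Ioc_mem_nhds hα.1 hneg)).deriv_eq_zero

end Envelope

theorem mainTheorem5 (δ : ℝ) (hδ0 : 0 < δ) (hδ1 : δ < 1) :
    (∀ α ∈ Ioc (δ - 1) 0,
      (∀ x ∈ Ioo (α - δ) (α + δ), DifferentiableAt ℝ (fun β : ℝ => greenTwo β δ x) α) ∧
      ∃! x : ℝ, x ∈ Ioo (α - δ) (α + δ) ∧ deriv (fun β : ℝ => greenTwo β δ x) α = 0) ∧
    ∀ x₀ ∈ Ioc (-1 : ℝ) 0,
      BddAbove ((fun α : ℝ => greenTwo α δ x₀) '' Ioc (δ - 1) 0) ∧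
      (∀ α ∈ Ioc (δ - 1) 0, greenTwo α δ x₀ = upperEnvelope δ x₀ →
        x₀ ∈ Ioo (α - δ) (α + δ) ∧
        deriv (fun β : ℝ => greenTwo β δ x₀) α = 0 ∧
        ∀ x ∈ Ioo (α - δ) (α + δ), deriv (fun β : ℝ => greenTwo β δ x) α = 0 → x = x₀) ∧
      ((¬ ∃ α ∈ Ioc (δ - 1) 0, greenTwo α δ x₀ = upperEnvelope δ x₀) →
        Tendsto (fun α : ℝ => greenTwo α δ x₀) (𝓝[>] (δ - 1)) (𝓝 (upperEnvelope δ x₀)) ∧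
        upperEnvelope δ x₀ = greenOne δ x₀) := by
  have hsub := Ioc_subset_Ioo_of_lt_one hδ1
  refine ⟨fun α hα => ⟨fun x hx => (hasDerivAt_greenTwo hδ0 (hsub hα) hx).differentiableAt,
    existsUnique_deriv_greenTwo_eq_zero hδ0 (hsub hα)⟩, fun x₀ hx₀ => ?_⟩
  have hx₀' : x₀ ∈ Ioc (-1 : ℝ) 1 := ⟨hx₀.1, by linarith [hx₀.2]⟩
  have hends : δ - 1 < 0 := by linarith
  have hcont : ContinuousOn (fun α => greenTwo α δ x₀) (Ioc (δ - 1) 0) := fun α hα =>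
    (continuousAt_greenTwo hδ0 (hsub hα) (Ioc_subset_Icc_self hx₀')).continuousWithinAt
  have hlim := tendsto_greenTwo hδ0 hδ1 hx₀'
  have hbdd := bddAbove_image_Ioc_of_tendsto hends hcont hlim
  refine ⟨hbdd, fun α hα hatt => ?_, fun hnot => ?_⟩
  · have hmax : IsMaxOn (fun β => greenTwo β δ x₀) (Ioc (δ - 1) 0) α := fun β hβ =>
      (le_csSup hbdd (mem_image_of_mem _ hβ)).trans_eq hatt.symm
    have hgap := mem_gap_of_isMaxOn hδ0 hδ1 hx₀ hα hmax
    have hderiv := deriv_greenTwo_eq_zero_of_isMaxOn hδ0 hδ1 hx₀.2 hα hgap hmax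
    exact ⟨hgap, hderiv, fun x hx hzero =>
      (existsUnique_deriv_greenTwo_eq_zero hδ0 (hsub hα)).unique ⟨hx, hzero⟩ ⟨hgap, hderiv⟩⟩
  · have hsup : upperEnvelope δ x₀ = greenOne δ x₀ :=
      sSup_image_Ioc_eq_of_tendsto hends hcont hlim hnot
    exact ⟨hsup ▸ hlim, hsup⟩
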